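/- **Parabolic intermediate value lemma.** Let $d\ge 1$, let $B_r(x_0)\subset\mathbb R^d$ be the open Euclidean ball, $B_r=B_r(0)$, let $Q_r=(-r^2,0)\times B_r$ and $\overline{Q_1}=(-2,-1)\times B_1$, and let $|E|$ denote the Lebesgue measure of $E$. Let $\gamma_1,\gamma_2,\gamma_3>0$ and $1\le p\le\frac{d+2}{d}$. The De Giorgi class $DG^+(\gamma_1,\gamma_2,\gamma_3,p)$ on $Q_2=(-4,0)\times B_2$ is the set of functions $u=u(t,x)$ with $u\in L^\infty((-4,0);L^2(B_2))$ and weak spatial gradient $\nabla_xu\in L^2(Q_2)$ such that, for all $k\in\mathbb R$, all $0<r<R$ and all $x_0\in B_2$ with $B_R(x_0)\subset B_2$, for almost every $s\in(-4,0)$ and almost every $t\in(s,0)$, $$\int_{B_r(x_0)}(u-k)_+^2(t,x)\,dx+\gamma_1\int_s^t\!\!\int_{B_r(x_0)}|\nabla_x(u-k)_+|^2\,dx\,d\tau\le\int_{B_R(x_0)}(u-k)_+^2(s,x)\,dx+\frac{\gamma_2}{(R-r)^2}\int_s^t\!\!\int_{B_R(x_0)}(u-k)_+^2\,dx\,d\tau+\gamma_3\Big(\int_s^t\!\!\int_{B_R(x_0)}(u-k)_+^p\,dx\,d\tau\Big)^{1/p},$$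 where $v_+=\max(v,0)$. For every $k\in\mathbb R$ there is a constant $C>0$, depending only on $d,k,\gamma_1,\gamma_2,\gamma_3$ and $p$, such that for every $u\in DG^+(\gamma_1,\gamma_2,\gamma_3,p)$ on $Q_2$ with $u\le 1$ almost everywhere on $Q_{3/2}$ and every $l$ with $k<l\le 1$, $$(l-k)^2\,\big|\{u\le k\}\cap\overline{Q_1}\big|\,\big|\{u\ge l\}\cap Q_1\big|\le C\,\big|\{k<u<l\}\cap Q_2\big|^{\frac1{4p+2}}.$$ -/

import Mathlib

open MeasureTheory Set
open scoped ENNReal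

namespace ParabolicDG

/-- `ℝ^d` with its Euclidean norm. -/
abbrev Space (d : ℕ) : Type := EuclideanSpace ℝ (Fin d)

/-- The parabolic cylinder `Q_r = (-r², 0) × B_r`. -/
def cylinder (d : ℕ) (r : ℝ) : Set (ℝ × Space d) :=
  Ioo (-r ^ 2) 0 ×ˢ Metric.ball (0 : Space d) r

/-- The earlier cylinder `(-2, -1) × B_1`. -/
def earlierCylinder (d : ℕ) : Set (ℝ × Space d) :=
  Ioo (-2 : ℝ) (-1) ×ˢ Metric.ball (0 : Space d) 1

/-- `G` is the weak spatial gradient `∇_x f` of `f` on the open set `Q` of space-time: for every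
test function `φ ∈ C_c^∞(Q)` and every spatial direction `e`,
`∫_Q f ∂_e φ = - ∫_Q φ ⟨G, e⟩`. -/
def HasWeakSpatialGradient {d : ℕ} (Q : Set (ℝ × Space d)) (f : ℝ × Space d → ℝ)
    (G : ℝ × Space d → Space d) : Prop :=
  LocallyIntegrableOn f Q volume ∧ LocallyIntegrableOn G Q volume ∧
    ∀ φ : ℝ × Space d → ℝ, ContDiff ℝ ((⊤ : ℕ∞) : WithTop ℕ∞) φ → HasCompactSupport φ → tsupport φ ⊆ Q →
      ∀ e : Space d,
        ∫ z in Q, f z * fderiv ℝ φ z (0, e) = - ∫ z in Q, φ z * inner ℝ (G z) e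

/-- `u ∈ L^∞((T₁, T₂); L²(Ω))`, for `u` a function on space-time. -/
def MemLinftyL2 {d : ℕ} (Ω : Set (Space d)) (T₁ T₂ : ℝ) (u : ℝ × Space d → ℝ) : Prop :=
  AEStronglyMeasurable u (volume.restrict (Ioo T₁ T₂ ×ˢ Ω)) ∧
    ∃ M : ℝ≥0∞, M < ∞ ∧
      ∀ᵐ t ∂(volume.restrict (Ioo T₁ T₂)),
        eLpNorm (fun x => u (t, x)) 2 (volume.restrict Ω) ≤ M

/-- The positive part `(u - k)_+`. -/
def truncPos {d : ℕ} (u : ℝ × Space d → ℝ) (k : ℝ) (z : ℝ × Space d) : ℝ :=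
  max (u z - k) 0

/-- The local energy inequality of the De Giorgi sub-class at the level `k` between the times `s`
and `t`, on the balls `B_r(x₀) ⊆ B_R(x₀)`; here `G` stands for `∇_x (u - k)_+`.
All integrands are nonnegative, and all integrals are taken in `[0, ∞]`. -/
def EnergyInequality {d : ℕ} (γ₁ γ₂ γ₃ p : ℝ) (u : ℝ × Space d → ℝ) (k : ℝ)
    (G : ℝ × Space d → Space d) (x₀ : Space d) (r R s t : ℝ) : Prop :=
  (∫⁻ x in Metric.ball x₀ r, ENNReal.ofReal (truncPos u k (t, x) ^ 2))
      + ENNReal.ofReal γ₁ * (∫⁻ τ in Ioo s t, ∫⁻ x in Metric.ball x₀ r, ‖G (τ, x)‖ₑ ^ 2)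
    ≤ (∫⁻ x in Metric.ball x₀ R, ENNReal.ofReal (truncPos u k (s, x) ^ 2))
      + ENNReal.ofReal (γ₂ / (R - r) ^ 2) *
          (∫⁻ τ in Ioo s t, ∫⁻ x in Metric.ball x₀ R, ENNReal.ofReal (truncPos u k (τ, x) ^ 2))
      + ENNReal.ofReal γ₃ *
          (∫⁻ τ in Ioo s t, ∫⁻ x in Metric.ball x₀ R,
            ENNReal.ofReal (truncPos u k (τ, x) ^ p)) ^ (1 / p)

/-- The parabolic De Giorgi sub-class `DG⁺(γ₁, γ₂, γ₃, p)` on `(T₁, T₂) × Ω`, for a bounded open set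
`Ω`, positive `γ₁, γ₂, γ₃` and `1 ≤ p ≤ (d + 2) / d`.  An element of `L^∞((T₁, T₂); L²(Ω))` has
values at almost every time only, so the energy inequality is required for almost every `s` and
almost every `t > s` in `(T₁, T₂)`. -/
structure DGPlus {d : ℕ} (Ω : Set (Space d)) (T₁ T₂ γ₁ γ₂ γ₃ p : ℝ)
    (u : ℝ × Space d → ℝ) : Prop where
  memLinftyL2 : MemLinftyL2 Ω T₁ T₂ u
  gradient_memL2 : ∃ G : ℝ × Space d → Space d,
    HasWeakSpatialGradient (Ioo T₁ T₂ ×ˢ Ω) u G ∧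
      MemLp G 2 (volume.restrict (Ioo T₁ T₂ ×ˢ Ω))
  energy : ∀ k : ℝ, ∃ G : ℝ × Space d → Space d,
    HasWeakSpatialGradient (Ioo T₁ T₂ ×ˢ Ω) (truncPos u k) G ∧
      ∀ r R : ℝ, 0 < r → r < R → ∀ x₀ ∈ Ω, Metric.ball x₀ R ⊆ Ω →
        ∀ᵐ s ∂(volume.restrict (Ioo T₁ T₂)), ∀ᵐ t ∂(volume.restrict (Ioo T₁ T₂)),
          s < t → EnergyInequality γ₁ γ₂ γ₃ p u k G x₀ r R s t

end ParabolicDG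

/-! Put `w = (u - k)_+`, `λ = l - k`, and on the unit ball, of volume `V`, let `A(t)`, `B(t)`,
`D(t)` be the measures of the slices `{w ≤ 0}`, `{w ≥ λ}`, `{0 < w < λ}` at time `t`. Let `μ` be the
space-time measure of the intermediate set.

In space, De Giorgi's isoperimetric inequality on each slice (`isoperimetric_inequality`),
Cauchy–Schwarz and an energy bound for the gradient give `∫ A B ≲ μ^(1/2) / λ`. So at most times one
of the two extreme phases is small, but this does not exclude a jump from one phase to the other as
time passes.

In time, the energy inequality forbids a jump upwards. Call a time good if `A B + D ≤ c λ²`. If a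
good time has `B ≤ V/4`, then `A ≥ V/2`, hence `B ≲ c λ²`, and `B ≤ V/4` persists for a duration `δ
~ λ^(2p)`, since the source term grows like `(t - s)^(1/p)` and has to stay below a multiple of
`λ²`. Bad times have total length below `δ/2`, so a good time always occurs soon enough to restart
the argument.

This yields a dichotomy (`time_propagation`). If some good time in `(-2, -1)` has `B ≤ V/4`, the
bound persists up to time `0` and `B ≲ A B + D` on `(-1, 0)`. Otherwise `A ≲ (A B + D) / λ²` almost
everywhere on `(-2, -1)`. In both cases integration concludes. The argument needs `μ^(1/(4p+2)) ≲
λ²`; when this fails the claim is trivial, because of the factor `(l - k)²`. -/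

namespace ParabolicDG

/-! ### Propagation in time -/

/-- A substitute for continuous induction when everything holds only almost everywhere: a window of
length `δ/2` cannot consist of bad times, so it contains a point from which the property is carried
a further `δ`. -/
theorem ae_forall_of_local_propagation {P g : ℝ → Prop} {δ s₀ : ℝ} (hδ : 0 < δ)
    (hs₀ : -2 < s₀)
    (hgood : volume {t | t ∈ Ioo (-2 : ℝ) 0 ∧ ¬ g t} < ENNReal.ofReal (δ / 2))
    (hstep : ∀ᵐ s ∂(volume.restrict (Ioo (-2 : ℝ) 0)), g s → P s →
      ∀ᵐ t ∂(volume.restrict (Ioo (-2 : ℝ) 0)), s < t → t < s + δ → P t)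
    (hstart : ∀ᵐ t ∂(volume.restrict (Ioo (-2 : ℝ) 0)), s₀ < t → t < s₀ + δ → P t) :
    ∀ᵐ t ∂(volume.restrict (Ioo (-2 : ℝ) 0)), s₀ < t → P t := by
  -- The start covers a full `δ`, hence `n + 2`. Each round restarts somewhere in the last
  -- half-window, so only a gain of `δ/2` is guaranteed.
  have key : ∀ n : ℕ, ∀ᵐ t ∂(volume.restrict (Ioo (-2 : ℝ) 0)),
      s₀ < t → t < s₀ + (n + 2) * (δ / 2) → P t := by
    intro n
    induction n with
    | zero =>
      filter_upwards [hstart] with t ht h1 h2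
      exact ht h1 (by norm_num at h2; linarith)
    | succ n ih =>
      by_cases hend : 0 ≤ s₀ + (n + 2) * (δ / 2)
      · filter_upwards [ih, ae_restrict_mem measurableSet_Ioo] with t ht hm h1 _
        exact ht h1 (lt_of_lt_of_le hm.2 hend)
      push Not at hend
      have hnδ : 0 ≤ (n : ℝ) * (δ / 2) := by positivity
      set I := Ioo (s₀ + (n + 1) * (δ / 2)) (s₀ + (n + 2) * (δ / 2)) with hI
      have hIsub : I ⊆ Ioo (-2 : ℝ) 0 := by
        intro t ht
        exact ⟨by nlinarith [ht.1], by linarith [ht.2]⟩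
      obtain ⟨s, hsI, hgs, hPs, hss⟩ : ∃ s ∈ I, g s ∧ P s ∧ (g s → P s →
          ∀ᵐ t ∂(volume.restrict (Ioo (-2 : ℝ) 0)), s < t → t < s + δ → P t) := by
        by_contra hcon
        simp only [not_exists, not_and] at hcon
        have hboth := hstep.and ih
        rw [ae_iff] at hboth
        have hle : volume I ≤ volume {t | t ∈ Ioo (-2 : ℝ) 0 ∧ ¬ g t} + 0 := by
          rw [← hboth]
          calc volume I ≤ volume ({t | t ∈ Ioo (-2 : ℝ) 0 ∧ ¬ g t} ∪
                ({a | ¬((g a → P a → ∀ᵐ t ∂(volume.restrict (Ioo (-2 : ℝ) 0)),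
                  a < t → t < a + δ → P t) ∧
                  (s₀ < a → a < s₀ + (n + 2) * (δ / 2) → P a))} ∩ Ioo (-2 : ℝ) 0)) := by
                apply measure_mono
                intro s hs
                by_cases hg : g s
                · right
                  refine ⟨fun h => ?_, hIsub hs⟩
                  have hP : P s := h.2 (by nlinarith [hs.1]) hs.2
                  exact hcon s hs hg hP h.1
                · left
                  exact ⟨hIsub hs, hg⟩
            _ ≤ _ := by
                refine (measure_union_le _ _).trans ?_
                exact add_le_add_right (Measure.le_restrict_apply _ _) _
        rw [add_zero, hI, Real.volume_Ioo] at hle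
        refine absurd (hle.trans_lt hgood) (not_lt.2 (ENNReal.ofReal_le_ofReal ?_))
        linarith
      filter_upwards [hss hgs hPs, ih] with t h1 h2 h3 h4
      by_cases hts : s < t
      · refine h1 hts ?_
        have := hsI.1
        push_cast at h4
        linarith
      · exact h2 h3 (lt_of_le_of_lt (not_lt.1 hts) hsI.2)
  obtain ⟨n, hn⟩ := exists_nat_gt (-s₀ / (δ / 2))
  filter_upwards [key n, ae_restrict_mem measurableSet_Ioo] with t ht hm h1
  refine ht h1 (hm.2.trans ?_)
  rw [div_lt_iff₀ (by positivity)] at hn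
  linarith

set_option maxHeartbeats 1000000 in
-- The dichotomy in time, freed of any reference to `u`. It is applied with `θ = λ / m`, where `m`
-- bounds `w`, and `x = μ^(1/(4p+2))`, so that `x^(2p+1) = μ^(1/2)` and `x^(4p+2) = μ`. The loss `V
-- / 8` comes from the smaller ball on the left of the energy inequality.
theorem time_propagation {p V K : ℝ} (hp : 1 ≤ p) (hV : 0 < V) (hK : 1 ≤ K) :
    ∃ C : ℝ, 0 < C ∧ ∀ (θ x : ℝ) (A B D : ℝ → ℝ), 0 < θ → θ ≤ 1 → 0 ≤ x →
      Measurable A → Measurable B → Measurable D →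
      (∀ t, 0 ≤ A t) → (∀ t, 0 ≤ B t) → (∀ t, 0 ≤ D t) → (∀ t, A t + B t + D t = V) →
      (∫ t in Ioo (-2 : ℝ) 0, A t * B t ≤ K * x ^ (2 * p + 1) / θ) →
      (∫ t in Ioo (-2 : ℝ) 0, D t ≤ x ^ (4 * p + 2)) →
      (∀ᵐ s ∂(volume.restrict (Ioo (-2 : ℝ) 0)), ∀ᵐ t ∂(volume.restrict (Ioo (-2 : ℝ) 0)),
        s < t → t ≤ s + 1 →
          θ ^ 2 * (B t - V / 8) ≤ K * (B s + D s) + K * (t - s) ^ (1 / p)) →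
      θ ^ 2 * (∫ t in Ioo (-2 : ℝ) (-1), A t) * (∫ t in Ioo (-1 : ℝ) 0, B t) ≤ C * x := by
  have hK0 : 0 < K := by linarith
  have hp0 : 0 < p := by linarith
  -- `c θ²` is the threshold for a good time and `c' θ^(2p)` the propagation time. Each contributes
  -- at most `θ² V / 16` to the energy inequality; together with the loss `V / 8` this reproduces
  -- exactly `B ≤ V / 4`.
  obtain ⟨c, hc0, hc1, hc2⟩ : ∃ c : ℝ, 0 < c ∧ c ≤ V / 4 ∧ K * (2 * c / V + c) ≤ V / 16 := by
    refine ⟨min (V / 4) (V / (16 * K * (2 / V + 1))), by positivity, min_le_left _ _, ?_⟩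
    have h := min_le_right (V / 4) (V / (16 * K * (2 / V + 1)))
    rw [le_div_iff₀ (by positivity)] at h
    set c := min (V / 4) (V / (16 * K * (2 / V + 1)))
    have : c * (16 * K * (2 / V + 1)) = 16 * (K * (2 * c / V + c)) := by field_simp
    linarith
  obtain ⟨c', hc'0, hc'1, hc'2⟩ : ∃ c' : ℝ, 0 < c' ∧ c' ≤ 1 ∧ K * c' ^ (1 / p) ≤ V / 16 := by
    refine ⟨min 1 ((V / (16 * K)) ^ p), by positivity, min_le_left _ _, ?_⟩
    have h : (min 1 ((V / (16 * K)) ^ p)) ^ (1 / p) ≤ V / (16 * K) := by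
      calc (min 1 ((V / (16 * K)) ^ p)) ^ (1 / p) ≤ ((V / (16 * K)) ^ p) ^ (1 / p) :=
            Real.rpow_le_rpow (by positivity) (min_le_right _ _) (by positivity)
        _ = V / (16 * K) := by
            rw [← Real.rpow_mul (by positivity), mul_one_div_cancel hp0.ne', Real.rpow_one]
    rw [le_div_iff₀ (by positivity)] at h
    linarith
  set c₃ : ℝ := min 1 (c * c' / (8 * K)) with hc₃
  have hc₃0 : 0 < c₃ := by positivity
  have hc₃1 : c₃ ≤ 1 := min_le_left _ _
  have hc₃2 : c₃ * (8 * K) ≤ c * c' := by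
    rw [← le_div_iff₀ (by positivity)]; exact min_le_right _ _
  refine ⟨V ^ 2 / c₃ + V * (2 / V + 1) * (2 * K) + V * (4 / V + V / c) * (2 * K), by positivity, ?_⟩
  intro θ x A B D hθ hθ1 hx hA hB hD hA0 hB0 hD0 hsum hAB hDx hprop
  have hAV : ∀ t, A t ≤ V := fun t => by linarith [hA0 t, hB0 t, hD0 t, hsum t]
  have hBV : ∀ t, B t ≤ V := fun t => by linarith [hA0 t, hB0 t, hD0 t, hsum t]
  have hDV : ∀ t, D t ≤ V := fun t => by linarith [hA0 t, hB0 t, hD0 t, hsum t]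
  have hint : ∀ (f : ℝ → ℝ) (M a b : ℝ), Measurable f → (∀ t, 0 ≤ f t) → (∀ t, f t ≤ M) →
      IntegrableOn f (Ioo a b) volume := by
    intro f M a b hf h0 h1
    refine Measure.integrableOn_of_bounded (M := M) (by simp) hf.aestronglyMeasurable ?_
    filter_upwards with t
    rw [Real.norm_of_nonneg (h0 t)]; exact h1 t
  have hAint := fun a b => hint A V a b hA hA0 hAV
  have hBint := fun a b => hint B V a b hB hB0 hBV
  have hDint := fun a b => hint D V a b hD hD0 hDV
  have hABint := fun a b => hint (fun t => A t * B t) (V * V) a b (hA.mul hB)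
    (fun t => mul_nonneg (hA0 t) (hB0 t)) (fun t => mul_le_mul (hAV t) (hBV t) (hB0 t) hV.le)
  set a := ∫ t in Ioo (-2 : ℝ) (-1), A t with ha
  set b := ∫ t in Ioo (-1 : ℝ) 0, B t with hb
  have hvol : ∀ y : ℝ, ∫ _ in Ioo y (y + 1), V = V := by
    intro y; simp
  have ha0 : 0 ≤ a := setIntegral_nonneg measurableSet_Ioo (fun t _ => hA0 t)
  have hb0 : 0 ≤ b := setIntegral_nonneg measurableSet_Ioo (fun t _ => hB0 t)
  have haV : a ≤ V := by
    have h := setIntegral_mono (hAint (-2) (-1)) (g := fun _ => V) (by simp) hAV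
    have h2 := hvol (-2)
    norm_num at h2 h
    linarith
  have hbV : b ≤ V := by
    have h := setIntegral_mono (hBint (-1) 0) (g := fun _ => V) (by simp) hBV
    have h2 := hvol (-1)
    norm_num at h2 h
    linarith
  have hθ2 : θ ^ 2 ≤ 1 := pow_le_one₀ hθ.le hθ1
  have hθ20 : 0 < θ ^ 2 := by positivity
  -- For such `x` the trivial bounds `a, b ≤ V` suffice, since `θ² ≤ x / c₃`.
  by_cases hxs : c₃ * θ ^ 2 < x
  · have h1 : θ ^ 2 * a * b ≤ θ ^ 2 * V * V := by gcongr
    have h2 : θ ^ 2 * V * V ≤ V ^ 2 / c₃ * x := by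
      have h3 : θ ^ 2 ≤ x / c₃ := by rw [le_div_iff₀ hc₃0]; linarith
      calc θ ^ 2 * V * V = V ^ 2 * θ ^ 2 := by ring
        _ ≤ V ^ 2 * (x / c₃) := by gcongr
        _ = _ := by ring
    have h3 : 0 ≤ (V * (2 / V + 1) * (2 * K) + V * (4 / V + V / c) * (2 * K)) * x := by positivity
    linarith
  push Not at hxs
  have hxθ : x ≤ θ ^ 2 := hxs.trans (by nlinarith)
  have hx1 : x ≤ 1 := hxθ.trans hθ2
  set J : ℝ := 2 * K * x ^ (2 * p + 1) / θ with hJ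
  have hJ0 : 0 ≤ J := by positivity
  have hIJ : K * x ^ (2 * p + 1) / θ + x ^ (4 * p + 2) ≤ J := by
    have h1 : x ^ (4 * p + 2) ≤ x ^ (2 * p + 1) :=
      Real.rpow_le_rpow_of_exponent_ge' hx hx1 (by linarith) (by linarith)
    have h2 : x ^ (2 * p + 1) ≤ K * x ^ (2 * p + 1) / θ := by
      rw [le_div_iff₀ hθ]
      have : 0 ≤ x ^ (2 * p + 1) := by positivity
      nlinarith
    have h3 : J = K * x ^ (2 * p + 1) / θ + K * x ^ (2 * p + 1) / θ := by rw [hJ]; ring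
    linarith
  have hsplit : x ^ (2 * p + 1) = x * x ^ (2 * p) := by
    rw [Real.rpow_add_one' hx (by linarith)]; ring
  have hx2p : x ^ (2 * p) ≤ θ := by
    calc x ^ (2 * p) ≤ (θ ^ 2) ^ (2 * p) := Real.rpow_le_rpow hx hxθ (by linarith)
      _ = θ ^ (4 * p) := by
        rw [← Real.rpow_natCast, ← Real.rpow_mul hθ.le]; congr 1; push_cast; ring
      _ ≤ θ ^ (1 : ℝ) := Real.rpow_le_rpow_of_exponent_ge hθ hθ1 (by linarith)
      _ = θ := Real.rpow_one θ
  have hJx : J ≤ 2 * K * x := by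
    rw [hJ, hsplit, div_le_iff₀ hθ]
    have : x * x ^ (2 * p) ≤ x * θ := by gcongr
    nlinarith
  set δ : ℝ := c' * θ ^ (2 * p) with hδ
  have hδ0 : 0 < δ := by positivity
  have hδ1 : δ ≤ 1 := by
    have : θ ^ (2 * p) ≤ 1 := Real.rpow_le_one hθ.le hθ1 (by linarith)
    have h0 : 0 ≤ θ ^ (2 * p) := by positivity
    nlinarith
  have hδp : K * δ ^ (1 / p) ≤ θ ^ 2 * (V / 16) := by
    rw [hδ, Real.mul_rpow hc'0.le (by positivity), ← Real.rpow_mul hθ.le]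
    have : 2 * p * (1 / p) = (2 : ℕ) := by push_cast; field_simp
    rw [this, Real.rpow_natCast]
    calc K * (c' ^ (1 / p) * θ ^ 2) = θ ^ 2 * (K * c' ^ (1 / p)) := by ring
      _ ≤ _ := by gcongr
  -- the set of bad times is short
  have hJδ : J < c * θ ^ 2 * (δ / 2) := by
    -- From `x ≤ c₃ θ²` one gets `θ^(4p+2)`, and `4p + 2 ≥ 2p + 3`. The cube accounts for the `1/θ`
    -- in `J` and the `θ²` in the threshold.
    have h1 : x ^ (2 * p + 1) ≤ c₃ * (θ ^ 3 * θ ^ (2 * p)) := by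
      calc x ^ (2 * p + 1) ≤ (c₃ * θ ^ 2) ^ (2 * p + 1) := Real.rpow_le_rpow hx hxs (by linarith)
        _ = c₃ ^ (2 * p + 1) * (θ ^ 2) ^ (2 * p + 1) := Real.mul_rpow hc₃0.le hθ20.le
        _ ≤ c₃ ^ (1 : ℝ) * (θ ^ 3 * θ ^ (2 * p)) := by
            gcongr ?_ * ?_
            · exact Real.rpow_le_rpow_of_exponent_ge hc₃0 hc₃1 (by linarith)
            · rw [← Real.rpow_natCast, ← Real.rpow_natCast, ← Real.rpow_mul hθ.le,
                ← Real.rpow_add hθ]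
              refine Real.rpow_le_rpow_of_exponent_ge hθ hθ1 ?_
              push_cast; linarith
        _ = _ := by rw [Real.rpow_one]
    have h2 : 0 < θ ^ 3 * θ ^ (2 * p) := by positivity
    rw [hJ, div_lt_iff₀ hθ]
    calc 2 * K * x ^ (2 * p + 1) ≤ 2 * K * (c₃ * (θ ^ 3 * θ ^ (2 * p))) := by gcongr
      _ = (c₃ * (8 * K)) / 4 * (θ ^ 3 * θ ^ (2 * p)) := by ring
      _ ≤ (c * c') / 4 * (θ ^ 3 * θ ^ (2 * p)) := by gcongr
      _ < (c * c') / 2 * (θ ^ 3 * θ ^ (2 * p)) := by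
          have : 0 < c * c' := by positivity
          gcongr; norm_num
      _ = c * θ ^ 2 * (δ / 2) * θ := by rw [hδ]; ring
  have hABD : ∫ t in Ioo (-2 : ℝ) 0, (A t * B t + D t) ≤ J := by
    rw [integral_add (hABint _ _) (hDint _ _)]; linarith
  set g : ℝ → Prop := fun t => A t * B t + D t ≤ c * θ ^ 2 with hg
  have hε : 0 < c * θ ^ 2 := by positivity
  have hbad : volume {t | t ∈ Ioo (-2 : ℝ) 0 ∧ ¬ g t} < ENNReal.ofReal (δ / 2) := by
    have hmark := mul_meas_ge_le_integral_of_nonneg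
      (μ := volume.restrict (Ioo (-2 : ℝ) 0)) (f := fun t => A t * B t + D t)
      (Filter.Eventually.of_forall fun t => add_nonneg (mul_nonneg (hA0 t) (hB0 t)) (hD0 t))
      ((hABint _ _).add (hDint _ _)) (c * θ ^ 2)
    set S := {t | c * θ ^ 2 ≤ A t * B t + D t} with hS
    have hSm : MeasurableSet S := measurableSet_le measurable_const ((hA.mul hB).add hD)
    have hreal : (volume.restrict (Ioo (-2 : ℝ) 0)).real S < δ / 2 := by
      have := (hmark.trans hABD).trans_lt hJδ
      exact lt_of_mul_lt_mul_left this hε.le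
    calc volume {t | t ∈ Ioo (-2 : ℝ) 0 ∧ ¬ g t} ≤ volume (S ∩ Ioo (-2 : ℝ) 0) := by
          apply measure_mono
          intro t ht
          exact ⟨(not_le.1 ht.2).le, ht.1⟩
      _ = (volume.restrict (Ioo (-2 : ℝ) 0)) S := (Measure.restrict_apply hSm).symm
      _ < _ := by
          rw [← ENNReal.ofReal_toReal (measure_ne_top (volume.restrict (Ioo (-2 : ℝ) 0)) S)]
          exact (ENNReal.ofReal_lt_ofReal_iff (by positivity)).2 hreal
  have hcV : c * θ ^ 2 ≤ V / 4 := by nlinarith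
  have hstep : ∀ s, (∀ᵐ t ∂(volume.restrict (Ioo (-2 : ℝ) 0)), s < t → t ≤ s + 1 →
          θ ^ 2 * (B t - V / 8) ≤ K * (B s + D s) + K * (t - s) ^ (1 / p)) → g s → B s ≤ V / 4 →
      ∀ᵐ t ∂(volume.restrict (Ioo (-2 : ℝ) 0)), s < t → t < s + δ → B t ≤ V / 4 := by
    intro s hs hgs hBs
    filter_upwards [hs] with t ht h1 h2
    have h3 := ht h1 (by linarith)
    have hDs : D s ≤ c * θ ^ 2 := by
      have := mul_nonneg (hA0 s) (hB0 s)
      simp only [hg] at hgs; linarith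
    have hAs : V / 2 ≤ A s := by linarith [hsum s]
    -- Self-improvement: `B ≤ V / 4` at a good time is upgraded to order `θ²`, which is what the
    -- energy inequality can propagate.
    have hBs2 : B s ≤ 2 * c / V * θ ^ 2 := by
      have h4 : A s * B s ≤ c * θ ^ 2 := by
        simp only [hg] at hgs; linarith [hD0 s]
      have h5 : V / 2 * B s ≤ c * θ ^ 2 := (mul_le_mul_of_nonneg_right hAs (hB0 s)).trans h4
      rw [div_mul_eq_mul_div, le_div_iff₀ hV]; linarith
    have h6 : (t - s) ^ (1 / p) ≤ δ ^ (1 / p) :=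
      Real.rpow_le_rpow (by linarith) (by linarith) (by positivity)
    have h7 : θ ^ 2 * (B t - V / 8) ≤ θ ^ 2 * (V / 8) := by
      calc _ ≤ _ := h3
        _ ≤ K * (2 * c / V * θ ^ 2 + c * θ ^ 2) + K * δ ^ (1 / p) := by gcongr
        _ ≤ θ ^ 2 * (V / 16) + θ ^ 2 * (V / 16) := by
            refine add_le_add ?_ hδp
            calc _ = θ ^ 2 * (K * (2 * c / V + c)) := by ring
              _ ≤ _ := by gcongr
        _ = _ := by ring
    have := le_of_mul_le_mul_left h7 hθ20
    linarith
  have hABmono : ∀ y z : ℝ, -2 ≤ y → z ≤ 0 →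
      ∫ t in Ioo y z, (A t * B t + D t) ≤ J := by
    intro y z hy hz
    refine le_trans (setIntegral_mono_set ((hABint _ _).add (hDint _ _)) ?_ ?_) hABD
    · exact Filter.Eventually.of_forall fun t => add_nonneg (mul_nonneg (hA0 t) (hB0 t)) (hD0 t)
    · exact (Ioo_subset_Ioo hy hz).eventuallyLE
  have hsmall : ∀ (f : ℝ → ℝ) (y z L : ℝ), -2 ≤ y → z ≤ 0 → 0 ≤ L →
      (∀ᵐ t ∂(volume.restrict (Ioo y z)), f t ≤ L * (A t * B t + D t)) →
      IntegrableOn f (Ioo y z) volume → ∫ t in Ioo y z, f t ≤ L * J := by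
    intro f y z L hy hz hL hf hfi
    calc ∫ t in Ioo y z, f t ≤ ∫ t in Ioo y z, L * (A t * B t + D t) :=
          integral_mono_ae hfi (((hABint _ _).add (hDint _ _)).const_mul L) hf
      _ = L * ∫ t in Ioo y z, (A t * B t + D t) := integral_const_mul _ _
      _ ≤ L * J := mul_le_mul_of_nonneg_left (hABmono y z hy hz) hL
  -- The propagation property of `s₀` is part of the alternative because it is known only for almost
  -- every starting time.
  by_cases hcase : ∃ s₀ ∈ Ioo (-2 : ℝ) (-1), g s₀ ∧ B s₀ ≤ V / 4 ∧
      (∀ᵐ t ∂(volume.restrict (Ioo (-2 : ℝ) 0)), s₀ < t → t ≤ s₀ + 1 →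
          θ ^ 2 * (B t - V / 8) ≤ K * (B s₀ + D s₀) + K * (t - s₀) ^ (1 / p))
  · obtain ⟨s₀, hs₀, hg₀, hB₀, hh₀⟩ := hcase
    have hall := ae_forall_of_local_propagation (P := fun t => B t ≤ V / 4) (g := g) hδ0 hs₀.1 hbad
      (by filter_upwards [hprop] with s hs h1 h2 using hstep s hs h1 h2) (hstep s₀ hh₀ hg₀ hB₀)
    have hb' : b ≤ (2 / V + 1) * J := by
      refine hsmall B (-1) 0 _ (by norm_num) le_rfl (by positivity) ?_ (hBint _ _)
      have hall' := ae_restrict_of_ae_restrict_of_subset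
        (Ioo_subset_Ioo_left (by norm_num : (-2 : ℝ) ≤ -1)) hall
      filter_upwards [hall', ae_restrict_mem measurableSet_Ioo] with t ht hm
      have hBt := ht (hs₀.2.trans hm.1)
      have hAB0 := mul_nonneg (hA0 t) (hB0 t)
      by_cases hDt : D t ≤ V / 4
      · have hAt : V / 2 ≤ A t := by linarith [hsum t]
        have h5 : V / 2 * B t ≤ A t * B t := mul_le_mul_of_nonneg_right hAt (hB0 t)
        calc B t = 2 / V * (V / 2 * B t) := by field_simp
          _ ≤ 2 / V * (A t * B t + D t) := by gcongr; linarith [hD0 t]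
          _ ≤ _ := by
            have := hD0 t
            gcongr; linarith
      · have h5 : B t ≤ 1 * (A t * B t + D t) := by linarith
        refine h5.trans ?_
        have := hD0 t
        gcongr
        have : 0 < 2 / V := by positivity
        linarith
    calc θ ^ 2 * a * b ≤ 1 * V * ((2 / V + 1) * (2 * K * x)) := by
          gcongr
          exact hb'.trans (by gcongr)
      _ = V * (2 / V + 1) * (2 * K) * x := by ring
      _ ≤ _ := by
          have h3 : 0 ≤ (V ^ 2 / c₃ + V * (4 / V + V / c) * (2 * K)) * x := by positivity
          linarith
  · simp only [not_exists, not_and] at hcase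
    -- Good times have `B ≥ V / 4` almost everywhere; bad times are paid for by Markov's inequality,
    -- at a cost `1 / θ²` that the factor `θ²` in the conclusion absorbs.
    have ha' : a ≤ (4 / V + V / (c * θ ^ 2)) * J := by
      refine hsmall A (-2) (-1) _ le_rfl (by norm_num) (by positivity) ?_ (hAint _ _)
      have hall' := ae_restrict_of_ae_restrict_of_subset
        (Ioo_subset_Ioo_right (by norm_num : (-1 : ℝ) ≤ 0)) hprop
      filter_upwards [hall', ae_restrict_mem measurableSet_Ioo] with t ht hm
      have hAB0 := mul_nonneg (hA0 t) (hB0 t)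
      by_cases hgt : g t
      · have hBt : V / 4 ≤ B t := by
          by_contra hlt
          exact hcase t hm hgt (not_le.1 hlt).le ht
        have h5 : A t * (V / 4) ≤ A t * B t := mul_le_mul_of_nonneg_left hBt (hA0 t)
        calc A t = 4 / V * (A t * (V / 4)) := by field_simp
          _ ≤ 4 / V * (A t * B t + D t) := by gcongr; linarith [hD0 t]
          _ ≤ _ := by
            have := hD0 t
            gcongr
            have : 0 < V / (c * θ ^ 2) := by positivity
            linarith
      · have h6 : c * θ ^ 2 ≤ A t * B t + D t := (not_le.1 hgt).le
        calc A t ≤ V := hAV t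
          _ = V / (c * θ ^ 2) * (c * θ ^ 2) := by field_simp
          _ ≤ V / (c * θ ^ 2) * (A t * B t + D t) := by gcongr
          _ ≤ _ := by
            have := hD0 t
            gcongr
            have : 0 < 4 / V := by positivity
            linarith
    calc θ ^ 2 * a * b ≤ θ ^ 2 * ((4 / V + V / (c * θ ^ 2)) * (2 * K * x)) * V := by
          gcongr
          exact ha'.trans (by gcongr)
      _ = V * (4 / V * θ ^ 2 + V / c) * (2 * K * x) := by field_simp
      _ ≤ V * (4 / V * 1 + V / c) * (2 * K * x) := by gcongr
      _ = V * (4 / V + V / c) * (2 * K) * x := by ring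
      _ ≤ _ := by
          have h3 : 0 ≤ (V ^ 2 / c₃ + V * (2 / V + 1) * (2 * K)) * x := by positivity
          linarith

/-! ### Mean oscillation on a convex set -/

theorem lintegral_comp_add_smul {d : ℕ} {H : Space d → ℝ≥0∞} (hH : Measurable H) {s : ℝ}
    (hs : 0 < s) (a : Space d) :
    ∫⁻ y, H (a + s • y) = ENNReal.ofReal ((s ^ d)⁻¹) * ∫⁻ y, H y := by
  have h1 : ∫⁻ y, H (a + s • y) = ∫⁻ z, H (a + z) ∂(Measure.map (fun y : Space d => s • y) volume) := by
    rw [lintegral_map (by fun_prop) (by fun_prop)]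
  rw [h1, Measure.map_addHaar_smul _ hs.ne', lintegral_smul_measure, lintegral_add_left_eq_self,
    finrank_euclideanSpace, Fintype.card_fin, abs_of_pos (by positivity), smul_eq_mul]

theorem lintegral_convexComb_le {d : ℕ} {B : Set (Space d)} (hB : MeasurableSet B)
    (hconv : Convex ℝ B) {H : Space d → ℝ≥0∞} (hH : Measurable H) {s : ℝ} (hs : 1 / 2 ≤ s)
    (hs1 : s ≤ 1) {x : Space d} (hx : x ∈ B) :
    ∫⁻ y in B, H ((1 - s) • x + s • y) ≤ 2 ^ d * ∫⁻ y in B, H y := by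
  have hs0 : 0 < s := by linarith
  calc ∫⁻ y in B, H ((1 - s) • x + s • y)
      ≤ ∫⁻ y in B, (B.indicator H) ((1 - s) • x + s • y) := by
        refine setLIntegral_mono' hB fun y hy => ?_
        rw [indicator_of_mem (hconv hx hy (by linarith) hs0.le (by ring))]
    _ ≤ ∫⁻ y, (B.indicator H) ((1 - s) • x + s • y) := setLIntegral_le_lintegral _ _
    _ = ENNReal.ofReal ((s ^ d)⁻¹) * ∫⁻ y, B.indicator H y :=
        lintegral_comp_add_smul (hH.indicator hB) hs0 _
    _ ≤ 2 ^ d * ∫⁻ y in B, H y := by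
        rw [lintegral_indicator hB]
        gcongr
        rw [ENNReal.ofReal_le_iff_le_toReal (by simp)]
        rw [← inv_pow]
        simp only [ENNReal.toReal_pow, ENNReal.toReal_ofNat]
        gcongr
        rw [inv_le_comm₀ hs0 (by norm_num)]
        linarith

/-- Integrate first in whichever endpoint has weight at least `1/2`: that change of variables has
Jacobian factor at most `2^d`, uniformly in `s`. -/
theorem lintegral_lintegral_segment_le {d : ℕ} {B : Set (Space d)} (hB : MeasurableSet B)
    (hconv : Convex ℝ B) {H : Space d → ℝ≥0∞} (hH : Measurable H) {s : ℝ} (hs : 0 ≤ s)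
    (hs1 : s ≤ 1) :
    ∫⁻ x in B, ∫⁻ y in B, H (x + s • (y - x)) ≤ 2 ^ d * volume B * ∫⁻ y in B, H y := by
  have hrw : ∀ x y : Space d, x + s • (y - x) = (1 - s) • x + s • y := by
    intro x y; rw [smul_sub, sub_smul, one_smul]; abel
  have hconst : ∫⁻ _ in B, 2 ^ d * ∫⁻ y in B, H y = 2 ^ d * volume B * ∫⁻ y in B, H y := by
    rw [setLIntegral_const]; ring
  rw [← hconst]
  by_cases hhalf : 1 / 2 ≤ s
  · refine setLIntegral_mono' hB fun x hx => ?_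
    simp only [hrw]
    exact lintegral_convexComb_le hB hconv hH hhalf hs1 hx
  · rw [lintegral_lintegral_swap (by fun_prop)]
    refine setLIntegral_mono' hB fun y hy => ?_
    have := lintegral_convexComb_le hB hconv hH (s := 1 - s) (by linarith) (by linarith) hy
    refine le_trans (le_of_eq ?_) this
    congr 1; ext x
    rw [hrw]; congr 1; rw [sub_sub_cancel, add_comm]

/-- The fundamental theorem of calculus along the segment from `x` to `y`, then Tonelli and the
preceding average over segments. -/
theorem lintegral_oscillation_le {d : ℕ} {B : Set (Space d)} (hB : MeasurableSet B)
    (hconv : Convex ℝ B) {L : ℝ} (hdiam : ∀ x ∈ B, ∀ y ∈ B, ‖y - x‖ ≤ L)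
    {φ ψ : ℝ → ℝ} (hφ : ∀ r, HasDerivAt φ (ψ r) r) (hψ : Continuous ψ) (hψ0 : ∀ r, 0 ≤ ψ r)
    {f : Space d → ℝ} {f' : Space d → Space d →L[ℝ] ℝ} (hf : ∀ x, HasFDerivAt f (f' x) x)
    (hf' : Continuous f') {g : Space d → ℝ} (hg : Measurable g)
    (hg0 : ∀ x, 0 ≤ g x) (hfg : ∀ x ∈ B, ∀ e, |f' x e| ≤ g x * ‖e‖) :
    ∫⁻ x in B, ∫⁻ y in B, ‖φ (f y) - φ (f x)‖ₑ ≤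
      ENNReal.ofReal L * (2 ^ d * volume B) * ∫⁻ x in B, ENNReal.ofReal (ψ (f x) * g x) := by
  have hfc : Continuous f := continuous_iff_continuousAt.2 fun x => (hf x).continuousAt
  set H : Space d → ℝ≥0∞ := fun x => ENNReal.ofReal (ψ (f x) * g x) with hHdef
  have hH : Measurable H := by fun_prop
  have hpt : ∀ x ∈ B, ∀ y ∈ B, ‖φ (f y) - φ (f x)‖ₑ ≤
      ENNReal.ofReal L * ∫⁻ s in Ioc (0 : ℝ) 1, H (x + s • (y - x)) := by
    intro x hx y hy
    have hline : ∀ s : ℝ, HasDerivAt (fun s : ℝ => φ (f (x + s • (y - x))))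
        (ψ (f (x + s • (y - x))) * f' (x + s • (y - x)) (y - x)) s := by
      intro s
      have h1 : HasDerivAt (fun s : ℝ => x + s • (y - x)) (y - x) s := by
        simpa using ((hasDerivAt_id s).smul_const (y - x)).const_add x
      exact (hφ _).comp s ((hf _).comp_hasDerivAt s h1)
    have hcont : Continuous fun s : ℝ =>
        ψ (f (x + s • (y - x))) * f' (x + s • (y - x)) (y - x) := by fun_prop
    have hftc := intervalIntegral.integral_eq_sub_of_hasDerivAt (a := (0 : ℝ)) (b := 1)
      (fun s _ => hline s) (hcont.intervalIntegrable _ _)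
    simp only [one_smul, zero_smul, add_zero, add_sub_cancel] at hftc
    rw [← hftc, intervalIntegral.integral_of_le zero_le_one,
      ← lintegral_const_mul _ (by fun_prop)]
    refine (enorm_integral_le_lintegral_enorm _).trans ?_
    refine setLIntegral_mono' measurableSet_Ioc fun s hs => ?_
    have hmem : x + s • (y - x) ∈ B := by
      have := hconv hx hy (by linarith [hs.2] : 0 ≤ 1 - s) hs.1.le (by ring)
      convert this using 1
      rw [smul_sub, sub_smul, one_smul]; abel
    rw [← ofReal_norm, hHdef, ← ENNReal.ofReal_mul ((norm_nonneg _).trans (hdiam x hx y hy))]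
    refine ENNReal.ofReal_le_ofReal ?_
    rw [Real.norm_eq_abs, abs_mul, abs_of_nonneg (hψ0 _)]
    have h1 := hψ0 (f (x + s • (y - x)))
    have h2 := hg0 (x + s • (y - x))
    calc ψ (f (x + s • (y - x))) * |f' (x + s • (y - x)) (y - x)|
        ≤ ψ (f (x + s • (y - x))) * (g (x + s • (y - x)) * ‖y - x‖) := by
          gcongr; exact hfg _ hmem _
      _ ≤ ψ (f (x + s • (y - x))) * (g (x + s • (y - x)) * L) := by
          gcongr; exact hdiam x hx y hy
      _ = _ := by ring
  calc ∫⁻ x in B, ∫⁻ y in B, ‖φ (f y) - φ (f x)‖ₑ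
      ≤ ∫⁻ x in B, ∫⁻ y in B, ENNReal.ofReal L * ∫⁻ s in Ioc (0 : ℝ) 1, H (x + s • (y - x)) :=
        setLIntegral_mono' hB fun x hx => setLIntegral_mono' hB fun y hy => hpt x hx y hy
    _ = ENNReal.ofReal L * ∫⁻ x in B, ∫⁻ y in B, ∫⁻ s in Ioc (0 : ℝ) 1, H (x + s • (y - x)) := by
        rw [← lintegral_const_mul' _ _ ENNReal.ofReal_ne_top]
        congr 1; ext x
        rw [lintegral_const_mul' _ _ ENNReal.ofReal_ne_top]
    _ = ENNReal.ofReal L * ∫⁻ s in Ioc (0 : ℝ) 1, ∫⁻ x in B, ∫⁻ y in B, H (x + s • (y - x)) := by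
        congr 1
        rw [lintegral_lintegral_swap (f := fun (s : ℝ) (x : Space d) =>
          ∫⁻ y in B, H (x + s • (y - x))) (by fun_prop)]
        refine lintegral_congr fun x => ?_
        rw [lintegral_lintegral_swap (by fun_prop)]
    _ ≤ ENNReal.ofReal L * ∫⁻ s in Ioc (0 : ℝ) 1, 2 ^ d * volume B * ∫⁻ x in B, H x := by
        refine mul_le_mul_right ?_ _
        exact setLIntegral_mono' measurableSet_Ioc fun s hs =>
          lintegral_lintegral_segment_le hB hconv hH hs.1.le hs.2
    _ = _ := by
        rw [setLIntegral_const, Real.volume_Ioc]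
        simp [mul_assoc]

/-! ### A `C¹` substitute for truncation -/

/-- The tent `max (0, 4 r (λ - r) / λ²)`. -/
noncomputable def tent (lam r : ℝ) : ℝ := max 0 (4 * r * (lam - r) / lam ^ 2)

/-- The primitive of the tent. -/
noncomputable def tentPrimitive (lam r : ℝ) : ℝ := ∫ q in (0 : ℝ)..r, tent lam q

theorem continuous_tent (lam : ℝ) : Continuous (tent lam) := by
  unfold tent; fun_prop

theorem tent_nonneg (lam r : ℝ) : 0 ≤ tent lam r := le_max_left _ _

theorem tent_le_one {lam : ℝ} (hlam : 0 < lam) (r : ℝ) : tent lam r ≤ 1 := by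
  refine max_le zero_le_one ?_
  rw [div_le_one (by positivity)]
  nlinarith [sq_nonneg (lam - 2 * r)]

theorem tent_eq_zero {lam r : ℝ} (hlam : 0 < lam) (h : r ≤ 0 ∨ lam ≤ r) : tent lam r = 0 := by
  refine max_eq_left (div_nonpos_of_nonpos_of_nonneg ?_ (by positivity))
  rcases h with h | h <;> nlinarith

/-- Continuity of the tent makes its primitive `C¹`, so the classical chain rule applies to
mollifications and the derivative passes to almost everywhere limits. The truncation `min (max r 0)
λ` would fail at its two corners. -/
theorem hasDerivAt_tentPrimitive (lam r : ℝ) :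
    HasDerivAt (tentPrimitive lam) (tent lam r) r :=
  intervalIntegral.integral_hasDerivAt_right ((continuous_tent lam).intervalIntegrable _ _)
    (continuous_tent lam).stronglyMeasurable.stronglyMeasurableAtFilter
    (continuous_tent lam).continuousAt

theorem tentPrimitive_of_nonpos {lam r : ℝ} (hlam : 0 < lam) (hr : r ≤ 0) :
    tentPrimitive lam r = 0 := by
  unfold tentPrimitive
  rw [intervalIntegral.integral_congr (g := fun _ => 0)]
  · simp
  · intro q hq
    rw [uIcc_of_ge hr] at hq
    exact tent_eq_zero hlam (Or.inl hq.2)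

theorem tentPrimitive_of_ge {lam r : ℝ} (hlam : 0 < lam) (hr : lam ≤ r) :
    tentPrimitive lam r = 2 * lam / 3 := by
  unfold tentPrimitive
  have hi := fun a b => (continuous_tent lam).intervalIntegrable (μ := volume) a b
  rw [← intervalIntegral.integral_add_adjacent_intervals (hi 0 lam) (hi lam r)]
  have h2 : ∫ q in lam..r, tent lam q = 0 := by
    rw [intervalIntegral.integral_congr (g := fun _ => 0)]
    · simp
    · intro q hq
      rw [uIcc_of_le hr] at hq
      exact tent_eq_zero hlam (Or.inr hq.1)
  have h1 : ∫ q in (0 : ℝ)..lam, tent lam q = ∫ q in (0 : ℝ)..lam, (4 / lam * q - 4 / lam ^ 2 * q ^ 2) := by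
    apply intervalIntegral.integral_congr
    intro q hq
    rw [uIcc_of_le hlam.le] at hq
    have h0 : 0 ≤ 4 * q * (lam - q) / lam ^ 2 :=
      div_nonneg (mul_nonneg (by linarith [hq.1]) (by linarith [hq.2])) (by positivity)
    simp only [tent, max_eq_right h0]
    field_simp
  rw [h2, h1, intervalIntegral.integral_sub (Continuous.intervalIntegrable (by fun_prop) _ _)
    (Continuous.intervalIntegrable (by fun_prop) _ _), intervalIntegral.integral_const_mul,
    intervalIntegral.integral_const_mul, integral_id, integral_pow]
  norm_num
  field_simp
  ring

/-! ### Mollification of a weak spatial gradient -/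

open scoped Convolution Topology
open Filter

instance isAddHaarMeasure_volume_spaceTime (d : ℕ) :
    (volume : Measure (ℝ × Space d)).IsAddHaarMeasure :=
  inferInstanceAs ((volume : Measure ℝ).prod (volume : Measure (Space d))).IsAddHaarMeasure

/-- The reflected kernel `z' ↦ η (z - z')` is itself an admissible test function; the reflection and
the weak formulation each contribute a sign, and these cancel. -/
theorem fderiv_convolution_eq_inner {d : ℕ} {Q K : Set (ℝ × Space d)}
    (hQ : IsOpen Q) (hK : IsCompact K) (hKQ : K ⊆ Q) {w : ℝ × Space d → ℝ}
    {G : ℝ × Space d → Space d} (h : HasWeakSpatialGradient Q w G)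
    {η : ℝ × Space d → ℝ} (hη : ContDiff ℝ ((⊤ : ℕ∞) : WithTop ℕ∞) η) (hηc : HasCompactSupport η)
    {z : ℝ × Space d} (hz : ∀ z', z - z' ∈ tsupport η → z' ∈ K) (e : Space d) :
    fderiv ℝ (η ⋆[ContinuousLinearMap.lsmul ℝ ℝ, volume] K.indicator w) z (0, e) =
      inner ℝ ((η ⋆[ContinuousLinearMap.lsmul ℝ ℝ, volume] K.indicator G) z) e := by
  obtain ⟨hw, hG, htest⟩ := h
  have hwi : Integrable (K.indicator w) volume :=
    (integrable_indicator_iff hK.measurableSet).2 (hw.integrableOn_compact_subset hKQ hK)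
  have hGi : Integrable (K.indicator G) volume :=
    (integrable_indicator_iff hK.measurableSet).2 (hG.integrableOn_compact_subset hKQ hK)
  have hη1 : ContDiff ℝ 1 η := hη.of_le (by exact_mod_cast le_top)
  have hd := (hηc.hasFDerivAt_convolution_left (ContinuousLinearMap.lsmul ℝ ℝ) hη1
    hwi.locallyIntegrable z).fderiv
  rw [hd, convolution_eq_swap]
  have hex1 : Integrable (fun t => ((ContinuousLinearMap.lsmul ℝ ℝ).precompL (ℝ × Space d))
      (fderiv ℝ η (z - t)) (K.indicator w t)) volume :=
    ((hηc.fderiv ℝ).convolutionExists_left _ (hη1.continuous_fderiv one_ne_zero)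
      hwi.locallyIntegrable z).integrable_swap
  rw [ContinuousLinearMap.integral_apply hex1]
  have hex2 : Integrable (fun t => η (z - t) • K.indicator G t) volume :=
    (hηc.convolutionExists_left (ContinuousLinearMap.lsmul ℝ ℝ) hη.continuous
      hGi.locallyIntegrable z).integrable_swap
  have hR : inner ℝ ((η ⋆[ContinuousLinearMap.lsmul ℝ ℝ, volume] K.indicator G) z) e =
      ∫ t, η (z - t) * inner ℝ (K.indicator G t) e := by
    rw [convolution_eq_swap]
    simp only [ContinuousLinearMap.lsmul_apply]
    rw [real_inner_comm, ← integral_inner hex2]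
    congr 1; ext t
    rw [inner_smul_right, real_inner_comm]
  rw [hR]
  set φ : ℝ × Space d → ℝ := fun z' => η (z - z') with hφ
  have hφs : ContDiff ℝ ((⊤ : ℕ∞) : WithTop ℕ∞) φ := hη.comp (contDiff_const.sub contDiff_id)
  have hφK : ∀ z', φ z' ≠ 0 → z' ∈ K := fun z' h' => hz z' (subset_tsupport _ h')
  have hφts : tsupport φ ⊆ K := closure_minimal hφK hK.isClosed
  have hφc : HasCompactSupport φ := hK.of_isClosed_subset (isClosed_tsupport _) hφts
  have hφd : ∀ z' v, fderiv ℝ φ z' v = - fderiv ℝ η (z - z') v := by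
    intro z' v
    have h1 : HasFDerivAt φ ((fderiv ℝ η (z - z')).comp (-(ContinuousLinearMap.id ℝ _))) z' := by
      refine ((hη1.differentiable one_ne_zero).differentiableAt.hasFDerivAt).comp z' ?_
      exact (hasFDerivAt_id z').const_sub z
    rw [h1.fderiv]; simp
  have ht := htest φ hφs hφc (hφts.trans hKQ) e
  have hfd0 : ∀ z', z' ∉ K → fderiv ℝ φ z' (0, e) = 0 := by
    intro z' hz'
    rw [fderiv_of_notMem_tsupport (𝕜 := ℝ) (fun hh => hz' (hφts hh))]; rfl
  have hL1 : ∫ z' in Q, w z' * fderiv ℝ φ z' (0, e) =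
      ∫ t, K.indicator w t * fderiv ℝ φ t (0, e) := by
    rw [← integral_indicator hQ.measurableSet]
    congr 1; ext t
    by_cases htK : t ∈ K
    · rw [indicator_of_mem (hKQ htK), indicator_of_mem htK]
    · rw [indicator_of_notMem htK, zero_mul]
      refine indicator_apply_eq_zero.2 fun _ => ?_
      rw [hfd0 t htK, mul_zero]
  have hL2 : ∫ z' in Q, φ z' * inner ℝ (G z') e =
      ∫ t, η (z - t) * inner ℝ (K.indicator G t) e := by
    rw [← integral_indicator hQ.measurableSet]
    congr 1; ext t
    by_cases htK : t ∈ K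
    · rw [indicator_of_mem (hKQ htK), indicator_of_mem htK]
    · rw [indicator_of_notMem htK, inner_zero_left, mul_zero]
      refine indicator_apply_eq_zero.2 fun _ => ?_
      rw [not_imp_comm.1 (hφK t) htK, zero_mul]
  rw [hL1, hL2] at ht
  rw [← neg_eq_iff_eq_neg.2 ht, ← integral_neg]
  congr 1; ext t
  rw [hφd, ContinuousLinearMap.precompL_apply]
  simp [mul_comm]

/-- Cutting off to a compact thickening of `K` makes the data globally integrable and leaves room
for small kernels. The majorant `N n`, the mollification of `‖G₀‖`, has the same mass for every `n`;
this replaces a fixed dominating function in the passage to the limit. -/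
theorem exists_mollification {d : ℕ} {Q K : Set (ℝ × Space d)}
    (hQ : IsOpen Q) (hK : IsCompact K) (hKQ : K ⊆ Q) {w : ℝ × Space d → ℝ}
    {G : ℝ × Space d → Space d} (h : HasWeakSpatialGradient Q w G) :
    ∃ (f : ℕ → ℝ × Space d → ℝ) (H : ℕ → ℝ × Space d → Space d) (N : ℕ → ℝ × Space d → ℝ)
      (G₀ : ℝ × Space d → Space d),
      (∀ n, ContDiff ℝ 1 (f n)) ∧ (∀ n, Continuous (H n)) ∧ (∀ n, Continuous (N n)) ∧
      (∀ n z, ‖H n z‖ ≤ N n z) ∧ Integrable G₀ volume ∧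
      (∀ n, ∫⁻ z, ENNReal.ofReal (N n z) = ∫⁻ z, ‖G₀ z‖ₑ) ∧
      (∀ᶠ n in atTop, ∀ z ∈ K, ∀ e, fderiv ℝ (f n) z (0, e) = inner ℝ (H n z) e) ∧
      (∀ᵐ z ∂(volume.restrict K), Tendsto (fun n => f n z) atTop (𝓝 (w z))) ∧
      (∀ᵐ z, Tendsto (fun n => H n z) atTop (𝓝 (G₀ z))) ∧
      (∀ᵐ z, Tendsto (fun n => N n z) atTop (𝓝 ‖G₀ z‖)) ∧
      ∀ z ∈ K, G₀ z = G z := by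
  obtain ⟨δ, hδ, hδQ⟩ := hK.exists_cthickening_subset_open hQ hKQ
  set K₁ := Metric.cthickening δ K with hK₁
  have hK₁c : IsCompact K₁ := hK.cthickening
  have hKK₁ : K ⊆ K₁ := Metric.self_subset_cthickening K
  have hwi : Integrable (K₁.indicator w) volume :=
    (integrable_indicator_iff hK₁c.measurableSet).2 (h.1.integrableOn_compact_subset hδQ hK₁c)
  have hGi : Integrable (K₁.indicator G) volume :=
    (integrable_indicator_iff hK₁c.measurableSet).2 (h.2.1.integrableOn_compact_subset hδQ hK₁c)
  let bump : ℕ → ContDiffBump (0 : ℝ × Space d) := fun n =>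
    ⟨1 / (2 * ((n : ℝ) + 1)), 1 / ((n : ℝ) + 1), by positivity, by
      apply one_div_lt_one_div_of_lt <;> [positivity; linarith [(n.cast_nonneg : (0 : ℝ) ≤ n)]]⟩
  have hrOut : Tendsto (fun n => (bump n).rOut) atTop (𝓝 0) := tendsto_one_div_add_atTop_nhds_zero_nat
  have hratio : ∀ᶠ n in atTop, (bump n).rOut ≤ 2 * (bump n).rIn := by
    refine Eventually.of_forall fun n => ?_
    change 1 / ((n : ℝ) + 1) ≤ 2 * (1 / (2 * ((n : ℝ) + 1)))
    rw [one_div, one_div, mul_inv]; linarith [inv_nonneg.2 (by positivity : (0 : ℝ) ≤ (n : ℝ) + 1)]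
  let η : ℕ → ℝ × Space d → ℝ := fun n => (bump n).normed volume
  have hηs : ∀ n, ContDiff ℝ ((⊤ : ℕ∞) : WithTop ℕ∞) (η n) := fun n => (bump n).contDiff_normed
  have hηc : ∀ n, HasCompactSupport (η n) := fun n => (bump n).hasCompactSupport_normed
  have hη0 : ∀ n z, 0 ≤ η n z := fun n z => (bump n).nonneg_normed z
  have hcont : ∀ (n : ℕ) {F : Type} [NormedAddCommGroup F] [NormedSpace ℝ F]
      (g : ℝ × Space d → F), Integrable g volume →
      Continuous (η n ⋆[ContinuousLinearMap.lsmul ℝ ℝ, volume] g) := fun n F _ _ g hg =>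
    (hηc n).continuous_convolution_left _ (hηs n).continuous hg.locallyIntegrable
  have hNint : ∀ n, Integrable (η n ⋆[ContinuousLinearMap.lsmul ℝ ℝ, volume]
      fun z => ‖K₁.indicator G z‖) volume := fun n =>
    ((bump n).integrable_normed).integrable_convolution _ hGi.norm
  have hN0 : ∀ n z, 0 ≤ (η n ⋆[ContinuousLinearMap.lsmul ℝ ℝ, volume]
      fun z => ‖K₁.indicator G z‖) z := fun n z =>
    integral_nonneg fun t => by
      simpa using mul_nonneg (hη0 n t) (norm_nonneg _)
  refine ⟨fun n => η n ⋆[ContinuousLinearMap.lsmul ℝ ℝ, volume] K₁.indicator w,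
    fun n => η n ⋆[ContinuousLinearMap.lsmul ℝ ℝ, volume] K₁.indicator G,
    fun n => η n ⋆[ContinuousLinearMap.lsmul ℝ ℝ, volume] fun z => ‖K₁.indicator G z‖,
    K₁.indicator G, ?_, fun n => hcont n _ hGi, fun n => hcont n _ hGi.norm, ?_, hGi, ?_, ?_, ?_,
    ?_, ?_, ?_⟩
  · intro n
    exact ((hηc n).contDiff_convolution_left _ (hηs n) hwi.locallyIntegrable).of_le
      (by exact_mod_cast le_top)
  · intro n z
    refine (norm_integral_le_integral_norm _).trans (le_of_eq ?_)
    congr 1; ext t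
    simp [norm_smul, abs_of_nonneg (hη0 n t)]
  · intro n
    rw [← ofReal_integral_eq_lintegral_ofReal (hNint n) (Eventually.of_forall (hN0 n)),
      integral_convolution _ ((bump n).integrable_normed) hGi.norm]
    simp only [ContinuousLinearMap.lsmul_apply]
    rw [(bump n).integral_normed, one_smul, ofReal_integral_norm_eq_lintegral_enorm hGi]
  · filter_upwards [hrOut.eventually (gt_mem_nhds hδ)] with n hn z hz e
    refine fderiv_convolution_eq_inner hQ hK₁c hδQ h (hηs n) (hηc n) ?_ e
    intro z' hz'
    rw [(bump n).tsupport_normed_eq, Metric.mem_closedBall, dist_zero_right] at hz'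
    refine Metric.mem_cthickening_of_dist_le z' z δ K hz ?_
    rw [dist_comm, dist_eq_norm]; linarith
  · have := ContDiffBump.ae_convolution_tendsto_right_of_locallyIntegrable (μ := volume) hrOut hratio
      hwi.locallyIntegrable
    filter_upwards [ae_restrict_of_ae this, ae_restrict_mem hK.measurableSet] with z hz hzK
    rwa [indicator_of_mem (hKK₁ hzK)] at hz
  · exact ContDiffBump.ae_convolution_tendsto_right_of_locallyIntegrable (μ := volume) hrOut hratio
      hGi.locallyIntegrable
  · exact ContDiffBump.ae_convolution_tendsto_right_of_locallyIntegrable (μ := volume) hrOut hratio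
      hGi.norm.locallyIntegrable
  · intro z hz
    rw [indicator_of_mem (hKK₁ hz)]

/-! ### De Giorgi's isoperimetric inequality, integrated in time -/

theorem lintegral_le_liminf_of_ae {α : Type*} [MeasurableSpace α] {μ : Measure α}
    {g : α → ℝ≥0∞} {F : ℕ → α → ℝ≥0∞} (hF : ∀ n, AEMeasurable (F n) μ)
    (hg : ∀ᵐ x ∂μ, g x ≤ liminf (fun n => F n x) atTop) :
    ∫⁻ x, g x ∂μ ≤ liminf (fun n => ∫⁻ x, F n x ∂μ) atTop :=
  (lintegral_mono_ae hg).trans (lintegral_liminf_le' hF)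

theorem ae_slice_of_ae_restrict_prod {d : ℕ} {I : Set ℝ} {B : Set (Space d)}
    {P : ℝ × Space d → Prop} (h : ∀ᵐ z ∂(volume.restrict (I ×ˢ B)), P z) :
    ∀ᵐ t ∂(volume.restrict I), ∀ᵐ x ∂(volume.restrict B), P (t, x) := by
  rw [Measure.volume_eq_prod, ← Measure.prod_restrict] at h
  exact Measure.ae_ae_of_ae_prod h

theorem volume_mul_volume_le_oscillation {d : ℕ} {B : Set (Space d)} (hB : MeasurableSet B)
    {lam : ℝ} (hlam : 0 < lam) {w : Space d → ℝ} (hw : Measurable w) :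
    ENNReal.ofReal (2 * lam / 3) *
        (volume ({x | w x ≤ 0} ∩ B) * volume ({x | lam ≤ w x} ∩ B)) ≤
      ∫⁻ x in B, ∫⁻ y in B, ‖tentPrimitive lam (w y) - tentPrimitive lam (w x)‖ₑ := by
  have hm0 : MeasurableSet {x | w x ≤ 0} := measurableSet_le hw measurable_const
  have hm1 : MeasurableSet {x | lam ≤ w x} := measurableSet_le measurable_const hw
  calc _ = ∫⁻ _ in {x | w x ≤ 0} ∩ B, ∫⁻ _ in {x | lam ≤ w x} ∩ B,
          ENNReal.ofReal (2 * lam / 3) := by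
        rw [setLIntegral_const, setLIntegral_const]; ring
    _ ≤ ∫⁻ x in {x | w x ≤ 0} ∩ B, ∫⁻ y in {x | lam ≤ w x} ∩ B,
          ‖tentPrimitive lam (w y) - tentPrimitive lam (w x)‖ₑ := by
        refine setLIntegral_mono' (hm0.inter hB) fun x hx =>
          setLIntegral_mono' (hm1.inter hB) fun y hy => ?_
        rw [tentPrimitive_of_nonpos hlam hx.1, tentPrimitive_of_ge hlam hy.1, sub_zero,
          Real.enorm_of_nonneg (by positivity)]
    _ ≤ _ := (lintegral_mono fun x => lintegral_mono_set inter_subset_right).trans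
        (lintegral_mono_set inter_subset_right)

theorem measurable_lintegral_slice {d : ℕ} (B : Set (Space d))
    {Φ : (ℝ × Space d) × Space d → ℝ≥0∞} (hΦ : Measurable Φ) (t : ℝ) :
    Measurable fun x : Space d => ∫⁻ y in B, Φ ((t, x), y) :=
  (hΦ.lintegral_prod_right' (ν := volume.restrict B)).comp measurable_prodMk_left

theorem measurable_lintegral_lintegral {d : ℕ} (B : Set (Space d))
    {Φ : (ℝ × Space d) × Space d → ℝ≥0∞} (hΦ : Measurable Φ) :
    Measurable fun t : ℝ => ∫⁻ x in B, ∫⁻ y in B, Φ ((t, x), y) :=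
  (hΦ.lintegral_prod_right' (ν := volume.restrict B)).lintegral_prod_right'
    (ν := volume.restrict B)

theorem lintegral_le_liminf_of_ae_slices {d : ℕ} {I : Set ℝ} {B : Set (Space d)}
    {Φ : ℕ → (ℝ × Space d) × Space d → ℝ≥0∞} {Ψ : (ℝ × Space d) × Space d → ℝ≥0∞}
    (hΦ : ∀ n, Measurable (Φ n))
    (h : ∀ᵐ t ∂(volume.restrict I), ∀ᵐ x ∂(volume.restrict B), ∀ᵐ y ∂(volume.restrict B),
      Ψ ((t, x), y) ≤ liminf (fun n => Φ n ((t, x), y)) atTop) :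
    ∫⁻ t in I, ∫⁻ x in B, ∫⁻ y in B, Ψ ((t, x), y) ≤
      liminf (fun n => ∫⁻ t in I, ∫⁻ x in B, ∫⁻ y in B, Φ n ((t, x), y)) atTop := by
  refine lintegral_le_liminf_of_ae (F := fun n t => ∫⁻ x in B, ∫⁻ y in B, Φ n ((t, x), y))
    (fun n => (measurable_lintegral_lintegral B (hΦ n)).aemeasurable) ?_
  filter_upwards [h] with t ht
  refine lintegral_le_liminf_of_ae (F := fun n x => ∫⁻ y in B, Φ n ((t, x), y))
    (fun n => (measurable_lintegral_slice B (hΦ n) t).aemeasurable) ?_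
  filter_upwards [ht] with x hx
  exact lintegral_le_liminf_of_ae (F := fun n y => Φ n ((t, x), y))
    (fun n => ((hΦ n).comp measurable_prodMk_left).aemeasurable) hx

set_option maxHeartbeats 1000000 in
-- The tent primitive separates the two extreme phases by `2λ/3`, while its derivative lives only on
-- the intermediate phase and is at most `1`. The oscillation bound is applied to mollifications,
-- slice by slice, and then passed to the limit.
theorem isoperimetric_inequality {d : ℕ} {a b a' b' ρ lam : ℝ} (haa' : a < a') (hbb' : b' < b)
    (hρ : 1 < ρ) (hlam : 0 < lam) {w : ℝ × Space d → ℝ} (hw : Measurable w)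
    {G : ℝ × Space d → Space d}
    (h : HasWeakSpatialGradient (Ioo a b ×ˢ Metric.ball (0 : Space d) ρ) w G) :
    ENNReal.ofReal (2 * lam / 3) * ∫⁻ t in Ioo a' b',
        volume ({x | w (t, x) ≤ 0} ∩ Metric.ball (0 : Space d) 1) *
          volume ({x | lam ≤ w (t, x)} ∩ Metric.ball (0 : Space d) 1) ≤
      ENNReal.ofReal 2 * (2 ^ d * volume (Metric.ball (0 : Space d) 1)) *
        ∫⁻ z in Ioo a' b' ×ˢ Metric.ball (0 : Space d) 1,
          {z | 0 < w z ∧ w z < lam}.indicator (fun z => ‖G z‖ₑ) z := by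
  set B := Metric.ball (0 : Space d) 1 with hBdef
  have hB : MeasurableSet B := measurableSet_ball
  set K := Icc a' b' ×ˢ Metric.closedBall (0 : Space d) 1 with hKdef
  set P := Ioo a' b' ×ˢ B with hPdef
  have hP : MeasurableSet P := measurableSet_Ioo.prod hB
  have hPK : P ⊆ K := prod_mono Ioo_subset_Icc_self Metric.ball_subset_closedBall
  have hK : IsCompact K := isCompact_Icc.prod (isCompact_closedBall _ _)
  have hKQ : K ⊆ Ioo a b ×ˢ Metric.ball (0 : Space d) ρ :=
    prod_mono (Icc_subset_Ioo haa' hbb') (Metric.closedBall_subset_ball hρ)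
  obtain ⟨f, H, N, G₀, hf, hH, hN, hHN, hG₀, hNint, hfd, hfw, hHG, hNG, hG₀G⟩ :=
    exists_mollification (isOpen_Ioo.prod Metric.isOpen_ball) hK hKQ h
  set c : ℝ≥0∞ := ENNReal.ofReal 2 * (2 ^ d * volume B) with hc
  have hc0 : c ≠ 0 := by
    have : volume B ≠ 0 := (Metric.measure_ball_pos volume _ one_pos).ne'
    simp [hc, this]
  have hctop : c ≠ ∞ := ENNReal.mul_ne_top ENNReal.ofReal_ne_top
    (ENNReal.mul_ne_top (by simp) measure_ball_lt_top.ne)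
  have hφc : Continuous (tentPrimitive lam) :=
    continuous_iff_continuousAt.2 fun r => (hasDerivAt_tentPrimitive lam r).continuousAt
  have hψc := continuous_tent lam
  set L : ℕ → ℝ≥0∞ := fun n => ∫⁻ t in Ioo a' b', ∫⁻ x in B, ∫⁻ y in B,
    ‖tentPrimitive lam (f n (t, y)) - tentPrimitive lam (f n (t, x))‖ₑ with hL
  set hh : ℕ → ℝ × Space d → ℝ≥0∞ := fun n =>
    P.indicator fun z => ENNReal.ofReal (tent lam (f n z) * ‖H n z‖) with hhdef
  set hlim : ℝ × Space d → ℝ≥0∞ :=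
    P.indicator fun z => ENNReal.ofReal (tent lam (w z) * ‖G₀ z‖) with hinf
  have hfcont : ∀ n, Continuous (f n) := fun n => (hf n).continuous
  have hfm : ∀ n, Measurable fun q : (ℝ × Space d) × Space d =>
      ‖tentPrimitive lam (f n (q.1.1, q.2)) - tentPrimitive lam (f n q.1)‖ₑ := by
    intro n
    have := hfcont n
    fun_prop
  have hhm : ∀ n, Measurable (hh n) := by
    intro n
    have := hfcont n
    have := hH n
    exact Measurable.indicator (by fun_prop) hP
  have hhN : ∀ n z, hh n z ≤ ENNReal.ofReal (N n z) := by
    intro n z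
    by_cases hz : z ∈ P
    · rw [hhdef]; simp only [indicator_of_mem hz]
      refine ENNReal.ofReal_le_ofReal ?_
      calc tent lam (f n z) * ‖H n z‖ ≤ 1 * ‖H n z‖ := by gcongr; exact tent_le_one hlam _
        _ ≤ N n z := by rw [one_mul]; exact hHN n z
    · rw [hhdef]; simp only [indicator_of_notMem hz]; exact zero_le
  set T := ∫⁻ z, ‖G₀ z‖ₑ with hT
  have hTtop : T ≠ ∞ := hG₀.2.ne
  have hJT : ∀ n, ∫⁻ z, hh n z ≤ T := fun n => (lintegral_mono (hhN n)).trans_eq (hNint n)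
  -- the smooth inequality
  have hLJ : ∀ᶠ n in atTop, L n ≤ c * ∫⁻ z, hh n z := by
    filter_upwards [hfd] with n hn
    have hslice : ∀ t ∈ Ioo a' b', ∫⁻ x in B, ∫⁻ y in B,
        ‖tentPrimitive lam (f n (t, y)) - tentPrimitive lam (f n (t, x))‖ₑ ≤
        c * ∫⁻ x in B, ENNReal.ofReal (tent lam (f n (t, x)) * ‖H n (t, x)‖) := by
      intro t ht
      have hfd' : ∀ x, HasFDerivAt (fun x => f n (t, x))
          ((fderiv ℝ (f n) (t, x)).comp (ContinuousLinearMap.inr ℝ ℝ (Space d))) x := by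
        intro x
        exact (((hf n).differentiable one_ne_zero).differentiableAt.hasFDerivAt).comp x
          (hasFDerivAt_prodMk_right t x)
      have hcd := (hf n).continuous_fderiv one_ne_zero
      have hHn := hH n
      refine lintegral_oscillation_le hB (convex_ball _ _) (L := 2) ?_
        (hasDerivAt_tentPrimitive lam) hψc (tent_nonneg lam) hfd' (by fun_prop)
        (g := fun x => ‖H n (t, x)‖) (by fun_prop) (fun x => norm_nonneg _) ?_
      · intro x hx y hy
        rw [hBdef, mem_ball_zero_iff] at hx hy
        exact (norm_sub_le _ _).trans (by linarith)
      · intro x hx e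
        have := hn (t, x) (hPK ⟨ht, hx⟩) e
        simp only [ContinuousLinearMap.comp_apply, ContinuousLinearMap.inr_apply]
        rw [this]
        exact abs_real_inner_le_norm _ _
    calc L n ≤ ∫⁻ t in Ioo a' b', c * ∫⁻ x in B,
            ENNReal.ofReal (tent lam (f n (t, x)) * ‖H n (t, x)‖) :=
          setLIntegral_mono' measurableSet_Ioo hslice
      _ = c * ∫⁻ z, hh n z := by
          rw [lintegral_const_mul' _ _ hctop, hhdef]
          simp only
          rw [lintegral_indicator hP, hPdef, Measure.volume_eq_prod, ← Measure.prod_restrict,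
            lintegral_prod]
          have := hfcont n
          have := hH n
          exact Measurable.aemeasurable (by fun_prop)
  -- lower semicontinuity of the oscillation
  have hLinf : (∫⁻ t in Ioo a' b', ∫⁻ x in B, ∫⁻ y in B,
      ‖tentPrimitive lam (w (t, y)) - tentPrimitive lam (w (t, x))‖ₑ) ≤ liminf L atTop := by
    have hconv := ae_slice_of_ae_restrict_prod (ae_restrict_of_ae_restrict_of_subset hPK hfw)
    refine lintegral_le_liminf_of_ae_slices (I := Ioo a' b') (B := B)
      (Ψ := fun q => ‖tentPrimitive lam (w (q.1.1, q.2)) - tentPrimitive lam (w q.1)‖ₑ) hfm ?_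
    filter_upwards [hconv] with t ht
    filter_upwards [ht] with x hx
    filter_upwards [ht] with y hy
    refine (Tendsto.liminf_eq ?_).ge
    exact (((hφc.tendsto _).comp hy).sub ((hφc.tendsto _).comp hx)).enorm
  have hG₀m : AEMeasurable (fun z => ‖G₀ z‖) volume := hG₀.1.norm.aemeasurable
  have hlimm : AEMeasurable hlim volume := by
    refine AEMeasurable.indicator ?_ hP
    have : Measurable fun z => tent lam (w z) := hψc.measurable.comp hw
    exact (this.aemeasurable.mul hG₀m).ennreal_ofReal
  have hlimle : ∀ z, hlim z ≤ ‖G₀ z‖ₑ := by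
    intro z
    by_cases hz : z ∈ P
    · rw [hinf]; simp only [indicator_of_mem hz]
      rw [← ofReal_norm]
      refine ENNReal.ofReal_le_ofReal ?_
      calc tent lam (w z) * ‖G₀ z‖ ≤ 1 * ‖G₀ z‖ := by gcongr; exact tent_le_one hlam _
        _ = _ := one_mul _
    · rw [hinf]; simp only [indicator_of_notMem hz]; exact zero_le
  -- Fatou for the nonnegative functions `N n - hh n`, whose first terms all have mass `T`, gives
  -- the upper semicontinuity needed on the gradient side.
  have hfat : T - ∫⁻ z, hlim z ≤ liminf (fun n => T - ∫⁻ z, hh n z) atTop := by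
    rw [hT, ← lintegral_sub' hlimm (ne_top_of_le_ne_top hTtop (lintegral_mono hlimle))
      (Eventually.of_forall hlimle)]
    have heq : ∀ n, (∫⁻ z, ‖G₀ z‖ₑ) - ∫⁻ z, hh n z = ∫⁻ z, (ENNReal.ofReal (N n z) - hh n z) := by
      intro n
      rw [lintegral_sub (hhm n) (ne_top_of_le_ne_top hTtop (hJT n))
        (Eventually.of_forall (hhN n)), hNint n]
    simp only [heq]
    refine lintegral_le_liminf_of_ae (fun n => ?_) ?_
    · have := hN n
      have := hhm n
      exact Measurable.aemeasurable (by fun_prop)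
    have hfw' := (ae_restrict_iff' hP).1 (ae_restrict_of_ae_restrict_of_subset hPK hfw)
    filter_upwards [hfw', hHG, hNG] with z h1 h2 h3
    refine (Tendsto.liminf_eq ?_).ge
    refine ENNReal.Tendsto.sub ?_ ?_ (Or.inl (by simp))
    · rw [← ofReal_norm]
      exact (ENNReal.continuous_ofReal.tendsto _).comp h3
    · by_cases hz : z ∈ P
      · rw [hinf, hhdef]; simp only [indicator_of_mem hz]
        exact (ENNReal.continuous_ofReal.tendsto _).comp
          (((hψc.tendsto _).comp (h1 hz)).mul h2.norm)
      · rw [hinf, hhdef]; simp only [indicator_of_notMem hz]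
        exact tendsto_const_nhds
  have hmain : (∫⁻ t in Ioo a' b', ∫⁻ x in B, ∫⁻ y in B,
      ‖tentPrimitive lam (w (t, y)) - tentPrimitive lam (w (t, x))‖ₑ) ≤ c * ∫⁻ z, hlim z := by
    refine le_of_forall_lt fun q hq => ?_
    obtain ⟨q', hqq', hq'⟩ := exists_between hq
    refine hqq'.trans_le ?_
    have hev : ∀ᶠ n in atTop, q' / c ≤ ∫⁻ z, hh n z := by
      filter_upwards [eventually_lt_of_lt_liminf (hq'.trans_le hLinf), hLJ] with n h1 h2
      exact ENNReal.div_le_of_le_mul' (h1.le.trans h2)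
    obtain ⟨n, hn⟩ := hev.exists
    have hle : T - ∫⁻ z, hlim z ≤ T - q' / c := by
      refine hfat.trans ?_
      refine liminf_le_of_frequently_le' (Eventually.frequently ?_)
      filter_upwards [hev] with n hn
      exact tsub_le_tsub_left hn _
    -- Subtraction is truncated in `[0, ∞]`; it can be undone because `q' / c ≤ T < ∞`.
    rw [ENNReal.sub_le_sub_iff_left (hn.trans (hJT n)) hTtop] at hle
    rwa [ENNReal.div_le_iff_le_mul (Or.inl hc0) (Or.inl hctop), mul_comm] at hle
  calc _ = ∫⁻ t in Ioo a' b', ENNReal.ofReal (2 * lam / 3) *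
        (volume ({x | w (t, x) ≤ 0} ∩ B) * volume ({x | lam ≤ w (t, x)} ∩ B)) := by
        rw [lintegral_const_mul' _ _ ENNReal.ofReal_ne_top]
    _ ≤ _ := lintegral_mono fun t =>
        volume_mul_volume_le_oscillation hB hlam (hw.comp measurable_prodMk_left)
    _ ≤ _ := hmain
    _ ≤ _ := by
        refine mul_le_mul_right ?_ _
        rw [hinf, lintegral_indicator hP]
        refine setLIntegral_mono' hP fun z hz => ?_
        rw [hG₀G z (hPK hz)]
        by_cases hwz : z ∈ {z | 0 < w z ∧ w z < lam}
        · rw [indicator_of_mem hwz, ← ofReal_norm]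
          refine ENNReal.ofReal_le_ofReal ?_
          calc tent lam (w z) * ‖G z‖ ≤ 1 * ‖G z‖ := by gcongr; exact tent_le_one hlam _
            _ = _ := one_mul _
        · have : tent lam (w z) = 0 := by
            apply tent_eq_zero hlam
            by_contra hcon
            push Not at hcon
            exact hwz hcon
          rw [this, zero_mul, ENNReal.ofReal_zero]; exact zero_le

/-! ### Consequences of the energy inequality -/

theorem HasWeakSpatialGradient.mono_congr {d : ℕ} {Q Q' : Set (ℝ × Space d)} (hQ : IsOpen Q)
    (hQ' : IsOpen Q') (hsub : Q' ⊆ Q) {f f' : ℝ × Space d → ℝ} {G : ℝ × Space d → Space d}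
    (h : HasWeakSpatialGradient Q f G) (hff' : f =ᵐ[volume.restrict Q'] f') :
    HasWeakSpatialGradient Q' f' G := by
  refine ⟨(h.1.mono_set hsub).congr hff', h.2.1.mono_set hsub, ?_⟩
  intro φ hφ hφc hφs e
  have ht := h.2.2 φ hφ hφc (hφs.trans hsub) e
  have h1 : ∫ z in Q', f' z * fderiv ℝ φ z (0, e) = ∫ z in Q, f z * fderiv ℝ φ z (0, e) := by
    have h2 : ∫ z in Q', f z * fderiv ℝ φ z (0, e) = ∫ z in Q, f z * fderiv ℝ φ z (0, e) := by
      refine (setIntegral_eq_of_subset_of_forall_sdiff_eq_zero hQ.measurableSet hsub ?_).symm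
      intro z hz
      rw [fderiv_of_notMem_tsupport (𝕜 := ℝ) (fun hh => hz.2 (hφs hh))]
      simp
    rw [← h2]
    refine setIntegral_congr_ae hQ'.measurableSet ?_
    filter_upwards [(ae_restrict_iff' hQ'.measurableSet).1 hff'] with z hz hzQ
    rw [hz hzQ]
  have h3 : ∫ z in Q', φ z * inner ℝ (G z) e = ∫ z in Q, φ z * inner ℝ (G z) e := by
    refine (setIntegral_eq_of_subset_of_forall_sdiff_eq_zero hQ.measurableSet hsub ?_).symm
    intro z hz
    rw [image_eq_zero_of_notMem_tsupport (fun hh => hz.2 (hφs hh)), zero_mul]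
  rw [h1, h3, ht]

theorem setLIntegral_Ioo_le_of_forall_lt {s b : ℝ} {F : ℝ → ℝ≥0∞} {M : ℝ≥0∞}
    (h : ∀ t < b, ∫⁻ τ in Ioo s t, F τ ≤ M) : ∫⁻ τ in Ioo s b, F τ ≤ M := by
  have hU : Ioo s b = ⋃ n : ℕ, Ioo s (b - 1 / ((n : ℝ) + 1)) := by
    ext τ
    simp only [mem_Ioo, mem_iUnion]
    constructor
    · rintro ⟨h1, h2⟩
      obtain ⟨n, hn⟩ := exists_nat_one_div_lt (sub_pos.2 h2)
      exact ⟨n, h1, by linarith⟩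
    · rintro ⟨n, h1, h2⟩
      have : 0 < 1 / ((n : ℝ) + 1) := by positivity
      exact ⟨h1, by linarith⟩
  rw [hU, setLIntegral_iUnion_of_directed]
  · refine iSup_le fun n => h _ ?_
    have : 0 < 1 / ((n : ℝ) + 1) := by positivity
    linarith
  · refine Monotone.directed_le fun n m hnm => Ioo_subset_Ioo_right ?_
    have : 1 / ((m : ℝ) + 1) ≤ 1 / ((n : ℝ) + 1) := Nat.one_div_le_one_div hnm
    linarith

theorem exists_mem_Ioo_of_ae {I : Set ℝ} {P : ℝ → Prop} (h : ∀ᵐ t ∂(volume.restrict I), P t)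
    {y z : ℝ} (hyz : y < z) (hI : Ioo y z ⊆ I) : ∃ t ∈ Ioo y z, P t := by
  have h1 := ae_restrict_of_ae_restrict_of_subset hI h
  have h2 := h1.and (ae_restrict_mem (μ := volume) measurableSet_Ioo)
  have : (ae (volume.restrict (Ioo y z))).NeBot := by
    rw [ae_neBot, Ne, Measure.restrict_eq_zero, Real.volume_Ioo, ENNReal.ofReal_eq_zero]
    linarith
  obtain ⟨t, ht1, ht2⟩ := h2.exists
  exact ⟨t, ht2, ht1⟩

theorem lintegral_gradient_le_of_ae {Φ : ℝ → ℝ≥0∞} {s : ℝ} {I : Set ℝ} {M : ℝ≥0∞}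
    (hs : s < 0) (hI : Ioo s 0 ⊆ I)
    (h : ∀ᵐ t ∂(volume.restrict I), s < t → ∫⁻ τ in Ioo s t, Φ τ ≤ M) :
    ∫⁻ τ in Ioo s 0, Φ τ ≤ M := by
  refine setLIntegral_Ioo_le_of_forall_lt fun t ht => ?_
  have hm : max s t < 0 := max_lt hs ht
  obtain ⟨t', ht', hle⟩ := exists_mem_Ioo_of_ae h hm
    ((Ioo_subset_Ioo_left (le_max_left _ _)).trans hI)
  refine le_trans (lintegral_mono_set (Ioo_subset_Ioo_right ?_))
    (hle ((le_max_left _ _).trans_lt ht'.1))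
  exact (le_max_right _ _).trans ht'.1.le

/-- With `r = 1 - 1/(8d)`, Bernoulli's inequality gives `r^d ≥ 7/8`. -/
theorem exists_radius (d : ℕ) (hd : 1 ≤ d) : ∃ r : ℝ, 0 < r ∧ r < 1 ∧
    volume.real (Metric.ball (0 : Space d) 1) - volume.real (Metric.ball (0 : Space d) r) ≤
      volume.real (Metric.ball (0 : Space d) 1) / 8 := by
  have hd' : (1 : ℝ) ≤ d := by exact_mod_cast hd
  have h8 : 1 / (8 * (d : ℝ)) ≤ 1 / 8 := by
    apply one_div_le_one_div_of_le <;> linarith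
  have h80 : 0 < 1 / (8 * (d : ℝ)) := by positivity
  have hr0 : 0 < 1 - 1 / (8 * (d : ℝ)) := by linarith
  refine ⟨1 - 1 / (8 * (d : ℝ)), hr0, by linarith, ?_⟩
  have : Nonempty (Fin d) := ⟨⟨0, hd⟩⟩
  have hvol : volume.real (Metric.ball (0 : Space d) (1 - 1 / (8 * (d : ℝ)))) =
      (1 - 1 / (8 * (d : ℝ))) ^ d * volume.real (Metric.ball (0 : Space d) 1) := by
    rw [measureReal_def, Measure.addHaar_ball _ _ hr0.le, finrank_euclideanSpace, Fintype.card_fin,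
      ENNReal.toReal_mul, ENNReal.toReal_ofReal (by positivity), measureReal_def]
  have hb := one_add_mul_le_pow (a := -(1 / (8 * (d : ℝ)))) (by linarith) d
  have he : 1 + (d : ℝ) * -(1 / (8 * (d : ℝ))) = 7 / 8 := by field_simp; norm_num
  rw [he] at hb
  rw [hvol, sub_eq_add_neg 1 (1 / (8 * (d : ℝ)))]
  have hV : 0 ≤ volume.real (Metric.ball (0 : Space d) 1) := measureReal_nonneg
  nlinarith

/-- The energy inequality for a representative `w` of `(u - k)_+` with `0 ≤ w ≤ m`, with the
lower-order terms bounded in terms of the elapsed time. -/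
theorem energy_bound {d : ℕ} {γ₁ γ₂ γ₃ p k m r R a : ℝ}
    (hγ₂ : 0 < γ₂) (hγ₃ : 0 < γ₃) (hp : 1 ≤ p) (hm : 0 < m)
    (hr : 0 < r) (hrR : r < R) (hR : R ≤ 2) (ha : -4 ≤ a)
    {u w : ℝ × Space d → ℝ} {G : ℝ × Space d → Space d}
    (hw : ∀ z, w z ≤ m) (hw0 : ∀ z, 0 ≤ w z)
    (huw : truncPos u k =ᵐ[volume.restrict (Ioo a 0 ×ˢ Metric.ball (0 : Space d) R)] w)
    (hE : ∀ r R : ℝ, 0 < r → r < R → ∀ x₀ ∈ Metric.ball (0 : Space d) 2,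
      Metric.ball x₀ R ⊆ Metric.ball (0 : Space d) 2 →
        ∀ᵐ s ∂(volume.restrict (Ioo (-4 : ℝ) 0)), ∀ᵐ t ∂(volume.restrict (Ioo (-4 : ℝ) 0)),
          s < t → EnergyInequality γ₁ γ₂ γ₃ p u k G x₀ r R s t) :
    ∀ᵐ s ∂(volume.restrict (Ioo a 0)), ∀ᵐ t ∂(volume.restrict (Ioo a 0)), s < t →
      (∫⁻ x in Metric.ball (0 : Space d) r, ENNReal.ofReal (w (t, x) ^ 2)) +
          ENNReal.ofReal γ₁ *
            (∫⁻ τ in Ioo s t, ∫⁻ x in Metric.ball (0 : Space d) r, ‖G (τ, x)‖ₑ ^ 2) ≤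
        (∫⁻ x in Metric.ball (0 : Space d) R, ENNReal.ofReal (w (s, x) ^ 2)) +
          ENNReal.ofReal (γ₂ / (R - r) ^ 2 *
              (m ^ 2 * volume.real (Metric.ball (0 : Space d) R)) * (t - s) +
            γ₃ * (m ^ p * volume.real (Metric.ball (0 : Space d) R)) ^ (1 / p) *
              (t - s) ^ (1 / p)) := by
  have hp0 : 0 < p := by linarith
  have hsub : Ioo a 0 ⊆ Ioo (-4 : ℝ) 0 := Ioo_subset_Ioo_left ha
  have hslice := ae_slice_of_ae_restrict_prod huw
  have hE0 := hE r R hr hrR 0 (Metric.mem_ball_self (by norm_num)) (Metric.ball_subset_ball hR)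
  set V := volume.real (Metric.ball (0 : Space d) R) with hV
  have hV0 : 0 ≤ V := measureReal_nonneg
  have hVe : volume (Metric.ball (0 : Space d) R) = ENNReal.ofReal V :=
    (ofReal_measureReal measure_ball_lt_top.ne).symm
  filter_upwards [ae_restrict_of_ae_restrict_of_subset hsub hE0, hslice,
    ae_restrict_mem measurableSet_Ioo] with s hs hs2 hsm
  filter_upwards [ae_restrict_of_ae_restrict_of_subset hsub hs, hslice,
    ae_restrict_mem measurableSet_Ioo] with t ht ht2 htm hst
  have hen := ht hst
  unfold EnergyInequality at hen
  have hball : Metric.ball (0 : Space d) r ⊆ Metric.ball 0 R := Metric.ball_subset_ball hrR.le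
  have h1 : ∫⁻ x in Metric.ball (0 : Space d) r, ENNReal.ofReal (truncPos u k (t, x) ^ 2) =
      ∫⁻ x in Metric.ball (0 : Space d) r, ENNReal.ofReal (w (t, x) ^ 2) := by
    refine lintegral_congr_ae ?_
    filter_upwards [ae_restrict_of_ae_restrict_of_subset hball ht2] with x hx
    rw [hx]
  have h2 : ∫⁻ x in Metric.ball (0 : Space d) R, ENNReal.ofReal (truncPos u k (s, x) ^ 2) =
      ∫⁻ x in Metric.ball (0 : Space d) R, ENNReal.ofReal (w (s, x) ^ 2) := by
    refine lintegral_congr_ae ?_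
    filter_upwards [hs2] with x hx
    rw [hx]
  have hpow : ∀ (Ψ : ℝ → ℝ) (c : ℝ), 0 ≤ c → (∀ y, 0 ≤ y → y ≤ m → Ψ y ≤ c) →
      ∫⁻ τ in Ioo s t, ∫⁻ x in Metric.ball (0 : Space d) R,
        ENNReal.ofReal (Ψ (truncPos u k (τ, x))) ≤ ENNReal.ofReal (c * V * (t - s)) := by
    intro Ψ c hc hΨ
    calc _ ≤ ∫⁻ τ in Ioo s t, ∫⁻ x in Metric.ball (0 : Space d) R, ENNReal.ofReal c := by
          refine lintegral_mono_ae ?_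
          have hss : Ioo s t ⊆ Ioo a 0 := Ioo_subset_Ioo hsm.1.le htm.2.le
          filter_upwards [ae_restrict_of_ae_restrict_of_subset hss hslice] with τ hτ
          refine lintegral_mono_ae ?_
          filter_upwards [hτ] with x hx
          rw [hx]
          exact ENNReal.ofReal_le_ofReal (hΨ _ (hw0 _) (hw _))
      _ = _ := by
          rw [setLIntegral_const, setLIntegral_const, Real.volume_Ioo, hVe,
            ← ENNReal.ofReal_mul hc, ← ENNReal.ofReal_mul (by positivity)]
  have h3 := hpow (fun y => y ^ 2) (m ^ 2) (by positivity) (fun y h0 hy => by gcongr)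
  have h4 := hpow (fun y => y ^ p) (m ^ p) (by positivity)
    (fun y h0 hy => Real.rpow_le_rpow h0 hy hp0.le)
  rw [h1, h2] at hen
  refine hen.trans ?_
  rw [add_assoc]
  refine add_le_add_right ?_ _
  have hts : 0 ≤ t - s := by linarith
  rw [ENNReal.ofReal_add (by positivity) (by positivity)]
  refine add_le_add ?_ ?_
  · rw [mul_assoc (γ₂ / (R - r) ^ 2), ENNReal.ofReal_mul (by positivity)]
    gcongr
  · rw [mul_assoc γ₃, ENNReal.ofReal_mul hγ₃.le, ← Real.mul_rpow (by positivity) hts,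
      ← ENNReal.ofReal_rpow_of_nonneg (by positivity) (by positivity)]
    gcongr

/-! ### Estimates for the level sets -/

theorem measurable_slice_volume {d : ℕ} {S : Set (ℝ × Space d)} (hS : MeasurableSet S)
    (B : Set (Space d)) : Measurable fun t : ℝ => volume ({x | (t, x) ∈ S} ∩ B) := by
  convert measurable_measure_prodMk_left (ν := volume.restrict B) hS using 2 with t
  rw [Measure.restrict_apply (measurable_prodMk_left hS)]
  rfl

theorem lintegral_slice_volume {d : ℕ} {S : Set (ℝ × Space d)} (hS : MeasurableSet S)
    (I : Set ℝ) (B : Set (Space d)) :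
    ∫⁻ t in I, volume ({x | (t, x) ∈ S} ∩ B) = volume (S ∩ I ×ˢ B) := by
  rw [← Measure.restrict_apply hS, Measure.volume_eq_prod, ← Measure.prod_restrict,
    Measure.prod_apply hS]
  refine lintegral_congr fun t => ?_
  rw [Measure.restrict_apply (measurable_prodMk_left hS)]
  rfl

theorem integral_slice_volume {d : ℕ} {S : Set (ℝ × Space d)} (hS : MeasurableSet S)
    (I : Set ℝ) {B : Set (Space d)} (hB : volume B ≠ ∞) :
    ∫ t in I, volume.real ({x | (t, x) ∈ S} ∩ B) = volume.real (S ∩ I ×ˢ B) := by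
  have hfin : ∀ t, volume ({x | (t, x) ∈ S} ∩ B) < ∞ := fun t =>
    (measure_mono inter_subset_right).trans_lt hB.lt_top
  simp only [measureReal_def]
  rw [integral_toReal (measurable_slice_volume hS B).aemeasurable (Eventually.of_forall hfin),
    lintegral_slice_volume hS I B]

/-- Mollification needs room before the final time, so the isoperimetric inequality is used up to
each `t < 0` and the bound passes to `0` by monotone exhaustion. Cauchy–Schwarz against the
indicator of the intermediate set produces the square roots. -/
theorem lintegral_level_sets_le {d : ℕ} {lam : ℝ} (hlam : 0 < lam) {w : ℝ × Space d → ℝ}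
    (hw : Measurable w) {G : ℝ × Space d → Space d}
    (h : HasWeakSpatialGradient (Ioo (-(9 / 4) : ℝ) 0 ×ˢ Metric.ball (0 : Space d) (3 / 2)) w G) :
    ENNReal.ofReal (2 * lam / 3) * ∫⁻ t in Ioo (-2 : ℝ) 0,
        volume ({x | w (t, x) ≤ 0} ∩ Metric.ball (0 : Space d) 1) *
          volume ({x | lam ≤ w (t, x)} ∩ Metric.ball (0 : Space d) 1) ≤
      ENNReal.ofReal 2 * (2 ^ d * volume (Metric.ball (0 : Space d) 1)) *
        (volume ({z | 0 < w z ∧ w z < lam} ∩ Ioo (-2 : ℝ) 0 ×ˢ Metric.ball (0 : Space d) 1) ^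
            (1 / 2 : ℝ) *
          (∫⁻ t in Ioo (-2 : ℝ) 0, ∫⁻ x in Metric.ball (0 : Space d) 1, ‖G (t, x)‖ₑ ^ 2) ^
            (1 / 2 : ℝ)) := by
  set B := Metric.ball (0 : Space d) 1 with hBdef
  set S := {z : ℝ × Space d | 0 < w z ∧ w z < lam} with hSdef
  have hS : MeasurableSet S :=
    (measurableSet_lt measurable_const hw).inter (measurableSet_lt hw measurable_const)
  have hPsub : Ioo (-2 : ℝ) 0 ×ˢ B ⊆ Ioo (-(9 / 4) : ℝ) 0 ×ˢ Metric.ball (0 : Space d) (3 / 2) :=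
    prod_mono (Ioo_subset_Ioo_left (by norm_num)) (Metric.ball_subset_ball (by norm_num))
  have hGm : AEMeasurable (fun z => ‖G z‖ₑ) (volume.restrict (Ioo (-2 : ℝ) 0 ×ˢ B)) :=
    (h.2.1.aestronglyMeasurable.mono_measure (Measure.restrict_mono hPsub le_rfl)).enorm
  have hsq : ∫⁻ z in Ioo (-2 : ℝ) 0 ×ˢ B, ‖G z‖ₑ ^ (2 : ℝ) =
      ∫⁻ t in Ioo (-2 : ℝ) 0, ∫⁻ x in B, ‖G (t, x)‖ₑ ^ 2 := by
    simp only [ENNReal.rpow_ofNat]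
    rw [Measure.volume_eq_prod, ← Measure.prod_restrict] at hGm ⊢
    exact lintegral_prod _ (hGm.pow_const 2)
  have hcs : ∫⁻ z in Ioo (-2 : ℝ) 0 ×ˢ B, S.indicator (fun z => ‖G z‖ₑ) z ≤
      volume (S ∩ Ioo (-2 : ℝ) 0 ×ˢ B) ^ (1 / 2 : ℝ) *
        (∫⁻ t in Ioo (-2 : ℝ) 0, ∫⁻ x in B, ‖G (t, x)‖ₑ ^ 2) ^ (1 / 2 : ℝ) := by
    have hh := ENNReal.lintegral_mul_le_Lp_mul_Lq (volume.restrict (Ioo (-2 : ℝ) 0 ×ˢ B))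
      Real.HolderConjugate.two_two (f := S.indicator 1) (g := fun z => ‖G z‖ₑ)
      ((measurable_one.indicator hS).aemeasurable) hGm
    have hone : ∀ z, (S.indicator (1 : ℝ × Space d → ℝ≥0∞) z) ^ (2 : ℝ) = S.indicator 1 z := by
      intro z
      by_cases hz : z ∈ S <;> simp [hz]
    simp only [hone] at hh
    rw [lintegral_indicator_one hS, Measure.restrict_apply hS, hsq] at hh
    refine le_trans (le_of_eq ?_) hh
    refine lintegral_congr fun z => ?_
    by_cases hz : z ∈ S <;> simp [hz]
  rw [← lintegral_const_mul' _ _ ENNReal.ofReal_ne_top]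
  refine setLIntegral_Ioo_le_of_forall_lt fun t ht => ?_
  rw [lintegral_const_mul' _ _ ENNReal.ofReal_ne_top]
  refine (isoperimetric_inequality (by norm_num) ht (by norm_num) hlam hw h).trans ?_
  refine mul_le_mul_right (le_trans ?_ hcs) _
  exact lintegral_mono_set (prod_mono (Ioo_subset_Ioo_right ht.le) le_rfl)

set_option maxHeartbeats 1000000 in
theorem level_set_estimate {d : ℕ} {p m r K M : ℝ} (hp : 1 ≤ p) (hm : 0 < m) (hr1 : r < 1)
    (hr : volume.real (Metric.ball (0 : Space d) 1) - volume.real (Metric.ball (0 : Space d) r) ≤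
      volume.real (Metric.ball (0 : Space d) 1) / 8) (hK : 0 ≤ K) (hM : 0 ≤ M) :
    ∃ C : ℝ, 0 < C ∧ ∀ (lam : ℝ) (w : ℝ × Space d → ℝ) (G : ℝ × Space d → Space d),
      0 < lam → lam ≤ m → Measurable w → (∀ z, 0 ≤ w z) → (∀ z, w z ≤ m) →
      HasWeakSpatialGradient (Ioo (-(9 / 4) : ℝ) 0 ×ˢ Metric.ball (0 : Space d) (3 / 2)) w G →
      (∫⁻ t in Ioo (-2 : ℝ) 0, ∫⁻ x in Metric.ball (0 : Space d) 1, ‖G (t, x)‖ₑ ^ 2 ≤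
        ENNReal.ofReal M) →
      (∀ᵐ s ∂(volume.restrict (Ioo (-2 : ℝ) 0)), ∀ᵐ t ∂(volume.restrict (Ioo (-2 : ℝ) 0)),
        s < t → t ≤ s + 1 →
          (∫⁻ x in Metric.ball (0 : Space d) r, ENNReal.ofReal (w (t, x) ^ 2)) ≤
            (∫⁻ x in Metric.ball (0 : Space d) 1, ENNReal.ofReal (w (s, x) ^ 2)) +
              ENNReal.ofReal (K * (t - s) ^ (1 / p))) →
      (lam / m) ^ 2 *
          volume.real ({z | w z ≤ 0} ∩ Ioo (-2 : ℝ) (-1) ×ˢ Metric.ball (0 : Space d) 1) *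
          volume.real ({z | lam ≤ w z} ∩ Ioo (-1 : ℝ) 0 ×ˢ Metric.ball (0 : Space d) 1) ≤
        C * volume.real ({z | 0 < w z ∧ w z < lam} ∩
          Ioo (-2 : ℝ) 0 ×ˢ Metric.ball (0 : Space d) 1) ^ (1 / (4 * p + 2)) := by
  have hm2 : 0 < m ^ 2 := by positivity
  set B := Metric.ball (0 : Space d) 1 with hBdef
  have hB : MeasurableSet B := measurableSet_ball
  have hBtop : volume B ≠ ∞ := measure_ball_lt_top.ne
  set V := volume.real B with hVdef
  have hV : 0 < V := ENNReal.toReal_pos (Metric.measure_ball_pos volume _ one_pos).ne' hBtop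
  have hVe : volume B = ENNReal.ofReal V := (ofReal_measureReal hBtop).symm
  -- The summands serve, in order, the initial term `B + D`, the source term divided by `m²`, and
  -- the isoperimetric bound for `∫ A B`, whose `3` is `2 · (3/2)`.
  set K₀ : ℝ := 1 + K / m ^ 2 + 3 * 2 ^ d * V * M ^ (1 / 2 : ℝ) / m with hK₀
  have hMr : 0 ≤ M ^ (1 / 2 : ℝ) := by positivity
  have hk1 : 0 ≤ K / m ^ 2 := by positivity
  have hk2 : 0 ≤ 3 * 2 ^ d * V * M ^ (1 / 2 : ℝ) / m := by positivity
  obtain ⟨C, hC, hmain⟩ := time_propagation (p := p) (V := V) (K := K₀) hp hV (by linarith)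
  refine ⟨C, hC, ?_⟩
  intro lam w G hlam hlamm hw hw0 hwm hG hGM hen
  set SA := {z : ℝ × Space d | w z ≤ 0} with hSA
  set SB := {z : ℝ × Space d | lam ≤ w z} with hSB
  set SD := {z : ℝ × Space d | 0 < w z ∧ w z < lam} with hSD
  have hSAm : MeasurableSet SA := measurableSet_le hw measurable_const
  have hSBm : MeasurableSet SB := measurableSet_le measurable_const hw
  have hSDm : MeasurableSet SD :=
    (measurableSet_lt measurable_const hw).inter (measurableSet_lt hw measurable_const)
  set A : ℝ → ℝ := fun t => volume.real ({x | (t, x) ∈ SA} ∩ B) with hA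
  set Bf : ℝ → ℝ := fun t => volume.real ({x | (t, x) ∈ SB} ∩ B) with hBf
  set D : ℝ → ℝ := fun t => volume.real ({x | (t, x) ∈ SD} ∩ B) with hD
  have hslm : ∀ {S : Set (ℝ × Space d)}, MeasurableSet S → ∀ t : ℝ,
      MeasurableSet {x | (t, x) ∈ S} := fun hS t => measurable_prodMk_left hS
  have hfin : ∀ S : Set (Space d), volume (S ∩ B) ≠ ∞ := fun S =>
    ((measure_mono inter_subset_right).trans_lt hBtop.lt_top).ne
  have hmeas : ∀ {S : Set (ℝ × Space d)}, MeasurableSet S →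
      Measurable fun t => volume.real ({x | (t, x) ∈ S} ∩ B) := fun hS =>
    (measurable_slice_volume hS B).ennreal_toReal
  have hposD : ∀ t, volume.real ({x | 0 < w (t, x)} ∩ B) ≤ Bf t + D t := by
    intro t
    refine le_trans (measureReal_mono ?_ ?_) (measureReal_union_le _ _)
    · rintro x ⟨hx, hxB⟩
      rcases le_or_gt lam (w (t, x)) with hl | hl
      · exact Or.inl ⟨hl, hxB⟩
      · exact Or.inr ⟨⟨hx, hl⟩, hxB⟩
    · exact (measure_union_lt_top (hfin _).lt_top (hfin _).lt_top).ne
  have hsum : ∀ t, A t + Bf t + D t = V := by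
    intro t
    have hAm := (hslm hSAm t).inter hB
    have hBm := (hslm hSBm t).inter hB
    have hDm := (hslm hSDm t).inter hB
    have hd1 : Disjoint ({x | (t, x) ∈ SA} ∩ B) ({x | (t, x) ∈ SB} ∩ B) := by
      rw [Set.disjoint_left]
      rintro x ⟨h1, -⟩ ⟨h2, -⟩
      have h1' : w (t, x) ≤ 0 := h1
      have h2' : lam ≤ w (t, x) := h2
      linarith
    have hd2 : Disjoint (({x | (t, x) ∈ SA} ∩ B) ∪ ({x | (t, x) ∈ SB} ∩ B))
        ({x | (t, x) ∈ SD} ∩ B) := by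
      rw [Set.disjoint_left]
      rintro x (⟨h1, -⟩ | ⟨h1, -⟩) ⟨⟨h2, h3⟩, -⟩
      · have h1' : w (t, x) ≤ 0 := h1
        linarith
      · have h1' : lam ≤ w (t, x) := h1
        linarith
    have hun : (({x | (t, x) ∈ SA} ∩ B) ∪ ({x | (t, x) ∈ SB} ∩ B)) ∪ ({x | (t, x) ∈ SD} ∩ B)
        = B := by
      ext x
      constructor
      · rintro ((h | h) | h) <;> exact h.2
      · intro hx
        rcases le_or_gt (w (t, x)) 0 with h0 | h0
        · exact Or.inl (Or.inl ⟨h0, hx⟩)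
        · rcases le_or_gt lam (w (t, x)) with hl | hl
          · exact Or.inl (Or.inr ⟨hl, hx⟩)
          · exact Or.inr ⟨⟨h0, hl⟩, hx⟩
    rw [hVdef, ← hun, measureReal_union hd2 hDm
      (measure_union_lt_top (hfin _).lt_top (hfin _).lt_top).ne (hfin _),
      measureReal_union hd1 hBm (hfin _) (hfin _)]
  set μ := volume.real (SD ∩ Ioo (-2 : ℝ) 0 ×ˢ B) with hμ
  have hμ0 : 0 ≤ μ := measureReal_nonneg
  have hQtop : volume (Ioo (-2 : ℝ) 0 ×ˢ B) ≠ ∞ := by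
    rw [Measure.volume_eq_prod, Measure.prod_prod]
    exact ENNReal.mul_ne_top (by simp) hBtop
  have hμe : volume (SD ∩ Ioo (-2 : ℝ) 0 ×ˢ B) = ENNReal.ofReal μ :=
    (ofReal_measureReal ((measure_mono inter_subset_right).trans_lt hQtop.lt_top).ne).symm
  have hpow : ∀ q : ℝ, (μ ^ (1 / (4 * p + 2))) ^ q = μ ^ (q / (4 * p + 2)) := by
    intro q
    rw [← Real.rpow_mul hμ0]; congr 1; ring
  have hp2 : 4 * p + 2 ≠ 0 := by positivity
  have hres := hmain (lam / m) (μ ^ (1 / (4 * p + 2))) A Bf D (by positivity)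
    ((div_le_one hm).2 hlamm) (by positivity) (hmeas hSAm) (hmeas hSBm) (hmeas hSDm)
    (fun t => measureReal_nonneg) (fun t => measureReal_nonneg) (fun t => measureReal_nonneg)
    hsum ?_ ?_ ?_
  · rw [integral_slice_volume hSAm _ hBtop, integral_slice_volume hSBm _ hBtop] at hres
    exact hres
  · have hiso := lintegral_level_sets_le hlam hw hG
    rw [hpow, show (2 * p + 1) / (4 * p + 2) = 1 / 2 by field_simp; ring]
    have hint : ∫ t in Ioo (-2 : ℝ) 0, A t * Bf t =
        (∫⁻ t in Ioo (-2 : ℝ) 0, volume ({x | w (t, x) ≤ 0} ∩ B) *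
          volume ({x | lam ≤ w (t, x)} ∩ B)).toReal := by
      have hABm : Measurable fun t => volume ({x | w (t, x) ≤ 0} ∩ B) *
          volume ({x | lam ≤ w (t, x)} ∩ B) :=
        (measurable_slice_volume hSAm B).mul (measurable_slice_volume hSBm B)
      rw [← integral_toReal hABm.aemeasurable (Eventually.of_forall fun t => 
        ENNReal.mul_lt_top (hfin _).lt_top (hfin _).lt_top)]
      simp only [ENNReal.toReal_mul]
      rfl
    have hiso2 : ENNReal.ofReal (2 * lam / 3) * ∫⁻ t in Ioo (-2 : ℝ) 0,
        volume ({x | w (t, x) ≤ 0} ∩ B) * volume ({x | lam ≤ w (t, x)} ∩ B) ≤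
        ENNReal.ofReal (2 * (2 ^ d * V) * (μ ^ (1 / 2 : ℝ) * M ^ (1 / 2 : ℝ))) := by
      refine hiso.trans ?_
      rw [hμe, hVe, ENNReal.ofReal_mul (by positivity), ENNReal.ofReal_mul (by positivity),
        ENNReal.ofReal_mul (by positivity), ENNReal.ofReal_mul (by positivity),
        ENNReal.ofReal_pow (by norm_num), ENNReal.ofReal_ofNat,
        ← ENNReal.ofReal_rpow_of_nonneg hμ0 (by norm_num),
        ← ENNReal.ofReal_rpow_of_nonneg hM (by norm_num)]
      gcongr
    have hreal := ENNReal.toReal_mono ENNReal.ofReal_ne_top hiso2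
    rw [ENNReal.toReal_mul, ENNReal.toReal_ofReal (by positivity),
      ENNReal.toReal_ofReal (by positivity), ← hint] at hreal
    have hle : ∫ t in Ioo (-2 : ℝ) 0, A t * Bf t ≤
        (3 * 2 ^ d * V * M ^ (1 / 2 : ℝ) / m) * μ ^ (1 / 2 : ℝ) / (lam / m) := by
      rw [le_div_iff₀ (by positivity)]
      have : (3 * 2 ^ d * V * M ^ (1 / 2 : ℝ) / m) * μ ^ (1 / 2 : ℝ) =
          3 / (2 * m) * (2 * (2 ^ d * V) * (μ ^ (1 / 2 : ℝ) * M ^ (1 / 2 : ℝ))) := by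
        field_simp
      rw [this]
      calc _ = 3 / (2 * m) * (2 * lam / 3 * ∫ t in Ioo (-2 : ℝ) 0, A t * Bf t) := by
            field_simp
        _ ≤ _ := by gcongr
    refine hle.trans ?_
    gcongr
    linarith
  · rw [hpow, div_self hp2, Real.rpow_one, integral_slice_volume hSDm _ hBtop]
  · filter_upwards [hen] with s hs
    filter_upwards [hs] with t ht hst hst1
    have h1 := ht hst hst1
    have hts : 0 ≤ t - s := by linarith
    have hball : Metric.ball (0 : Space d) r ⊆ B := Metric.ball_subset_ball hr1.le
    have hlow : ENNReal.ofReal (lam ^ 2 * (Bf t - V / 8)) ≤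
        ∫⁻ x in Metric.ball (0 : Space d) r, ENNReal.ofReal (w (t, x) ^ 2) := by
      have hsplit : Bf t - V / 8 ≤ volume.real ({x | (t, x) ∈ SB} ∩ Metric.ball (0 : Space d) r) := by
        have h2 : Bf t ≤ volume.real ({x | (t, x) ∈ SB} ∩ Metric.ball (0 : Space d) r) +
            volume.real (B \ Metric.ball (0 : Space d) r) := by
          refine le_trans (measureReal_mono ?_ ?_) (measureReal_union_le _ _)
          · rintro x ⟨hx, hxB⟩
            by_cases hxr : x ∈ Metric.ball (0 : Space d) r
            · exact Or.inl ⟨hx, hxr⟩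
            · exact Or.inr ⟨hxB, hxr⟩
          · refine (measure_union_lt_top ?_ ?_).ne
            · exact (measure_mono inter_subset_right).trans_lt measure_ball_lt_top
            · exact (measure_mono sdiff_subset).trans_lt hBtop.lt_top
        have h3 : volume.real (B \ Metric.ball (0 : Space d) r) =
            V - volume.real (Metric.ball (0 : Space d) r) :=
          measureReal_sdiff hball measurableSet_ball
        linarith
      calc ENNReal.ofReal (lam ^ 2 * (Bf t - V / 8))
          ≤ ENNReal.ofReal (lam ^ 2 *
              volume.real ({x | (t, x) ∈ SB} ∩ Metric.ball (0 : Space d) r)) := by gcongr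
        _ = ∫⁻ x in {x | (t, x) ∈ SB} ∩ Metric.ball (0 : Space d) r, ENNReal.ofReal (lam ^ 2) := by
            rw [setLIntegral_const, ENNReal.ofReal_mul (by positivity), ofReal_measureReal]
        _ ≤ ∫⁻ x in {x | (t, x) ∈ SB} ∩ Metric.ball (0 : Space d) r,
              ENNReal.ofReal (w (t, x) ^ 2) := by
            refine setLIntegral_mono' ((hslm hSBm t).inter measurableSet_ball) fun x hx => ?_
            have : lam ≤ w (t, x) := hx.1
            gcongr
        _ ≤ _ := lintegral_mono_set inter_subset_right
    have hup : ∫⁻ x in B, ENNReal.ofReal (w (s, x) ^ 2) ≤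
        ENNReal.ofReal (m ^ 2 * (Bf s + D s)) := by
      have hpm : MeasurableSet {x | 0 < w (s, x)} :=
        measurableSet_lt measurable_const (hw.comp measurable_prodMk_left)
      calc ∫⁻ x in B, ENNReal.ofReal (w (s, x) ^ 2)
          ≤ ∫⁻ x in B, {x | 0 < w (s, x)}.indicator (fun _ => ENNReal.ofReal (m ^ 2)) x := by
            refine lintegral_mono fun x => ?_
            by_cases hx : 0 < w (s, x)
            · rw [indicator_of_mem (show x ∈ {x | 0 < w (s, x)} from hx)]
              have := hwm (s, x)
              gcongr
            · have : w (s, x) = 0 := le_antisymm (not_lt.1 hx) (hw0 _)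
              simp [this]
        _ = ENNReal.ofReal (m ^ 2) * volume ({x | 0 < w (s, x)} ∩ B) := by
            rw [lintegral_indicator_const hpm, Measure.restrict_apply hpm]
        _ = ENNReal.ofReal (m ^ 2 * volume.real ({x | 0 < w (s, x)} ∩ B)) := by
            rw [ENNReal.ofReal_mul hm2.le, ofReal_measureReal (hfin _)]
        _ ≤ _ := by
            gcongr ENNReal.ofReal (m ^ 2 * ?_)
            exact hposD s
    have h2 := (hlow.trans h1).trans (add_le_add_left hup _)
    have hBD : 0 ≤ Bf s + D s := add_nonneg measureReal_nonneg measureReal_nonneg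
    rw [← ENNReal.ofReal_add (by positivity) (by positivity),
      ENNReal.ofReal_le_ofReal_iff (by positivity)] at h2
    have hpw : 0 ≤ (t - s) ^ (1 / p) := by positivity
    calc (lam / m) ^ 2 * (Bf t - V / 8) = (lam ^ 2 * (Bf t - V / 8)) / m ^ 2 := by
          rw [div_pow]; ring
      _ ≤ (m ^ 2 * (Bf s + D s) + K * (t - s) ^ (1 / p)) / m ^ 2 := by gcongr
      _ = 1 * (Bf s + D s) + K / m ^ 2 * (t - s) ^ (1 / p) := by field_simp
      _ ≤ _ := by gcongr <;> linarith

/-- The gap `(-9/4, -2)` supplies an admissible starting time `s`, from which the energy inequality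
controls the gradient on all of `(-2, 0)`; end times close to `0` suffice by monotonicity. -/
theorem gradient_bound_of_energy {d : ℕ} {γ₁ m K L : ℝ} (hγ₁ : 0 < γ₁)
    {q : ℝ} (hq : 0 ≤ q) (hK : 0 ≤ K) (hL : 0 ≤ L)
    {w : ℝ × Space d → ℝ} {G : ℝ × Space d → Space d} {r R : ℝ}
    (hw : ∀ z, w z ≤ m) (hw0 : ∀ z, 0 ≤ w z)
    (hen : ∀ᵐ s ∂(volume.restrict (Ioo (-(9 / 4) : ℝ) 0)),
      ∀ᵐ t ∂(volume.restrict (Ioo (-(9 / 4) : ℝ) 0)), s < t →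
      (∫⁻ x in Metric.ball (0 : Space d) r, ENNReal.ofReal (w (t, x) ^ 2)) +
          ENNReal.ofReal γ₁ *
            (∫⁻ τ in Ioo s t, ∫⁻ x in Metric.ball (0 : Space d) r, ‖G (τ, x)‖ₑ ^ 2) ≤
        (∫⁻ x in Metric.ball (0 : Space d) R, ENNReal.ofReal (w (s, x) ^ 2)) +
          ENNReal.ofReal (K * (t - s) + L * (t - s) ^ q)) :
    ∫⁻ τ in Ioo (-2 : ℝ) 0, ∫⁻ x in Metric.ball (0 : Space d) r, ‖G (τ, x)‖ₑ ^ 2 ≤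
      ENNReal.ofReal ((m ^ 2 * volume.real (Metric.ball (0 : Space d) R) +
        (K * (9 / 4) + L * (9 / 4) ^ q)) / γ₁) := by
  obtain ⟨s, hs, hsen⟩ := exists_mem_Ioo_of_ae hen (by norm_num : -(9 / 4 : ℝ) < -2)
    (Ioo_subset_Ioo_right (by norm_num))
  have hs0 : s < 0 := by linarith [hs.2]
  refine (lintegral_mono_set (Ioo_subset_Ioo_left hs.2.le)).trans
    (lintegral_gradient_le_of_ae hs0 (Ioo_subset_Ioo_left hs.1.le) ?_)
  filter_upwards [hsen, ae_restrict_mem measurableSet_Ioo] with t ht htm hst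
  have h1 := le_trans le_add_self (ht hst)
  have h2 : ∫⁻ x in Metric.ball (0 : Space d) R, ENNReal.ofReal (w (s, x) ^ 2) ≤
      ENNReal.ofReal (m ^ 2 * volume.real (Metric.ball (0 : Space d) R)) := by
    calc _ ≤ ∫⁻ _ in Metric.ball (0 : Space d) R, ENNReal.ofReal (m ^ 2) :=
          lintegral_mono fun x => ENNReal.ofReal_le_ofReal
            (pow_le_pow_left₀ (hw0 (s, x)) (hw (s, x)) 2)
      _ = _ := by
          rw [setLIntegral_const, ENNReal.ofReal_mul (by positivity),
            ofReal_measureReal measure_ball_lt_top.ne]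
  have hts : 0 ≤ t - s := by linarith
  have hts' : t - s ≤ 9 / 4 := by linarith [htm.2, hs.1]
  rw [ENNReal.ofReal_div_of_pos hγ₁, ENNReal.le_div_iff_mul_le (by simp [hγ₁]) (by simp), mul_comm]
  refine h1.trans ?_
  rw [ENNReal.ofReal_add (p := m ^ 2 * _) (by positivity) (by positivity)]
  exact add_le_add h2 (ENNReal.ofReal_le_ofReal (by gcongr))

end ParabolicDG

/-! ### The intermediate value lemma -/

open ParabolicDG in
theorem theorem1p5 (d : ℕ) (hd : 1 ≤ d) (γ₁ γ₂ γ₃ p k : ℝ)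
    (hγ₁ : 0 < γ₁) (hγ₂ : 0 < γ₂) (hγ₃ : 0 < γ₃)
    (hp₁ : 1 ≤ p) (hp₂ : p ≤ ((d : ℝ) + 2) / d) :
    ∃ C : ℝ, 0 < C ∧
      ∀ u : ℝ × ParabolicDG.Space d → ℝ,
        ParabolicDG.DGPlus (Metric.ball (0 : ParabolicDG.Space d) 2) (-4) 0 γ₁ γ₂ γ₃ p u →
        (∀ᵐ z ∂(volume.restrict (ParabolicDG.cylinder d (3 / 2))), u z ≤ 1) →
        ∀ l : ℝ, k < l → l ≤ 1 →
          (l - k) ^ 2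
              * volume.real ({z | u z ≤ k} ∩ ParabolicDG.earlierCylinder d)
              * volume.real ({z | l ≤ u z} ∩ ParabolicDG.cylinder d 1)
            ≤ C * volume.real ({z | k < u z ∧ u z < l} ∩ ParabolicDG.cylinder d 2)
                  ^ (1 / (4 * p + 2)) := by
  rcases le_or_gt 1 k with hk | hk
  · exact ⟨1, one_pos, fun u _ _ l h1 h2 => absurd (h1.trans_le h2) (not_lt.2 hk)⟩
  set m := 1 - k with hmdef
  have hm : 0 < m := by linarith
  obtain ⟨r, hr0, hr1, hr⟩ := exists_radius d hd
  set V := volume.real (Metric.ball (0 : Space d) 1) with hV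
  set V' := volume.real (Metric.ball (0 : Space d) (3 / 2)) with hV'
  have hV0 : 0 ≤ V := measureReal_nonneg
  have hV'0 : 0 ≤ V' := measureReal_nonneg
  have hp0 : 0 < p := by linarith
  have hr1' : 0 < 1 - r := by linarith
  set Ka := γ₂ / (1 - r) ^ 2 * (m ^ 2 * V) with hKa
  set Kb := γ₃ * (m ^ p * V) ^ (1 / p) with hKb
  have hKa0 : 0 ≤ Ka := by positivity
  have hKb0 : 0 ≤ Kb := by positivity
  set La := γ₂ / (3 / 2 - 1) ^ 2 * (m ^ 2 * V') with hLa
  set Lb := γ₃ * (m ^ p * V') ^ (1 / p) with hLb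
  have hLa0 : 0 ≤ La := by positivity
  have hLb0 : 0 ≤ Lb := by positivity
  obtain ⟨C, hC, hest⟩ := level_set_estimate (d := d) (p := p) (m := m) (r := r) (K := Ka + Kb)
    (M := (m ^ 2 * V' + (La * (9 / 4) + Lb * (9 / 4) ^ (1 / p))) / γ₁) hp₁ hm hr1 hr
    (by positivity) (by positivity)
  refine ⟨m ^ 2 * C, by positivity, ?_⟩
  intro u hu hu1 l hkl hl1
  obtain ⟨G, hG, hE⟩ := hu.energy k
  set lam := l - k with hlam
  have hlam0 : 0 < lam := by linarith
  have hlamm : lam ≤ m := by linarith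
  -- a bounded measurable representative of `(u - k)_+`
  have hum := hu.memLinftyL2.1
  set w : ℝ × Space d → ℝ := fun z => min (max (hum.mk u z - k) 0) m with hwdef
  have hwm : Measurable w :=
    ((hum.measurable_mk.sub_const k).max measurable_const).min measurable_const
  have hw0 : ∀ z, 0 ≤ w z := fun z => le_min (le_max_right _ _) hm.le
  have hwle : ∀ z, w z ≤ m := fun z => min_le_right _ _
  set Q' := Ioo (-(9 / 4) : ℝ) 0 ×ˢ Metric.ball (0 : Space d) (3 / 2) with hQ'
  have hcyl : ParabolicDG.cylinder d (3 / 2) = Q' := by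
    rw [hQ', ParabolicDG.cylinder]; norm_num
  have hQ'sub : Q' ⊆ Ioo (-4 : ℝ) 0 ×ˢ Metric.ball (0 : Space d) 2 :=
    prod_mono (Ioo_subset_Ioo_left (by norm_num)) (Metric.ball_subset_ball (by norm_num))
  have huw : truncPos u k =ᵐ[volume.restrict Q'] w := by
    rw [hcyl] at hu1
    filter_upwards [hu1, ae_restrict_of_ae_restrict_of_subset hQ'sub hum.ae_eq_mk] with z h1 h2
    rw [hwdef]
    simp only [truncPos]
    rw [← h2, min_eq_left (max_le (by linarith) hm.le)]
  have hQ'm : MeasurableSet Q' := measurableSet_Ioo.prod measurableSet_ball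
  have hGw : HasWeakSpatialGradient Q' w G :=
    hG.mono_congr (isOpen_Ioo.prod Metric.isOpen_ball) (isOpen_Ioo.prod Metric.isOpen_ball)
      hQ'sub huw
  -- The energy inequality is used on two pairs of balls: radii `1 < 3/2` for the gradient, and `r <
  -- 1` for propagation in time, where both sides must be compared on nearly the same ball.
  have hgrad := gradient_bound_of_energy hγ₁ (by positivity : 0 ≤ 1 / p) hLa0 hLb0 hwle hw0
    (energy_bound (r := 1) (R := 3 / 2) (a := -(9 / 4)) hγ₂ hγ₃ hp₁ hm one_pos (by norm_num)
      (by norm_num) (by norm_num) hwle hw0 huw hE)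
  have hsub2 : Ioo (-2 : ℝ) 0 ×ˢ Metric.ball (0 : Space d) 1 ⊆ Q' :=
    prod_mono (Ioo_subset_Ioo_left (by norm_num)) (Metric.ball_subset_ball (by norm_num))
  have hprop := energy_bound (r := r) (R := 1) (a := -2) hγ₂ hγ₃ hp₁ hm hr0 hr1
      (by norm_num) (by norm_num) hwle hw0 (ae_restrict_of_ae_restrict_of_subset hsub2 huw) hE
  have hfinal := hest lam w G hlam0 hlamm hwm hw0 hwle hGw hgrad (by
    filter_upwards [hprop] with s hs
    filter_upwards [hs] with t ht hst hst1
    refine (le_trans le_self_add (ht hst)).trans (add_le_add_right (ENNReal.ofReal_le_ofReal ?_) _)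
    -- For durations at most `1` the linear term is absorbed into the power `1/p`, leaving a single
    -- source term.
    have h1 : t - s ≤ (t - s) ^ (1 / p) := by
      refine Real.self_le_rpow_of_le_one (by linarith) (by linarith) ?_
      rw [div_le_one hp0]; exact hp₁
    have h2 : Ka * (t - s) ≤ Ka * (t - s) ^ (1 / p) := mul_le_mul_of_nonneg_left h1 hKa0
    linarith)
  have huw' := (ae_restrict_iff' hQ'm).1 huw
  have hcongr : ∀ {S S' E : Set (ℝ × Space d)}, E ⊆ Q' →
      (∀ z, truncPos u k z = w z → (z ∈ S ↔ z ∈ S')) →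
      volume.real (S ∩ E) = volume.real (S' ∩ E) := by
    intro S S' E hE hSS
    refine measureReal_congr ?_
    filter_upwards [huw'] with z hz
    refine propext ⟨fun h => ⟨(hSS z (hz (hE h.2))).1 h.1, h.2⟩,
      fun h => ⟨(hSS z (hz (hE h.2))).2 h.1, h.2⟩⟩
  have hAeq : volume.real ({z | u z ≤ k} ∩ earlierCylinder d) =
      volume.real ({z | w z ≤ 0} ∩ Ioo (-2 : ℝ) (-1) ×ˢ Metric.ball (0 : Space d) 1) := by
    refine hcongr (prod_mono (Ioo_subset_Ioo (by norm_num) (by norm_num))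
      (Metric.ball_subset_ball (by norm_num))) fun z hz => ?_
    simp only [mem_ofPred_eq, ← hz, truncPos]
    simp
  have hBeq : volume.real ({z | l ≤ u z} ∩ ParabolicDG.cylinder d 1) =
      volume.real ({z | lam ≤ w z} ∩ Ioo (-1 : ℝ) 0 ×ˢ Metric.ball (0 : Space d) 1) := by
    have : ParabolicDG.cylinder d 1 = Ioo (-1 : ℝ) 0 ×ˢ Metric.ball (0 : Space d) 1 := by
      rw [ParabolicDG.cylinder]; norm_num
    rw [this]
    refine hcongr (prod_mono (Ioo_subset_Ioo (by norm_num) (by norm_num))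
      (Metric.ball_subset_ball (by norm_num))) fun z hz => ?_
    simp only [mem_ofPred_eq, ← hz, truncPos, le_max_iff, hlam]
    constructor
    · intro h; left; linarith
    · rintro (h | h) <;> linarith
  have hDeq : volume.real ({z | 0 < w z ∧ w z < lam} ∩
        Ioo (-2 : ℝ) 0 ×ˢ Metric.ball (0 : Space d) 1) ≤
      volume.real ({z | k < u z ∧ u z < l} ∩ ParabolicDG.cylinder d 2) := by
    rw [← hcongr (S := {z | k < u z ∧ u z < l}) hsub2]
    · refine measureReal_mono (inter_subset_inter_right _ (prod_mono
        (Ioo_subset_Ioo_left (by norm_num)) (Metric.ball_subset_ball (by norm_num)))) ?_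
      refine ((measure_mono inter_subset_right).trans_lt ?_).ne
      rw [ParabolicDG.cylinder, Measure.volume_eq_prod, Measure.prod_prod]
      exact ENNReal.mul_lt_top (by simp) measure_ball_lt_top
    · intro z hz
      simp only [mem_ofPred_eq, ← hz, truncPos, lt_max_iff, max_lt_iff, hlam]
      constructor
      · rintro ⟨h1, h2⟩
        exact ⟨Or.inl (by linarith), by linarith, by linarith⟩
      · rintro ⟨h1 | h1, h2, h3⟩
        · exact ⟨by linarith, by linarith⟩
        · exact absurd h1 (lt_irrefl _)
  rw [hAeq, hBeq]
  set a := volume.real ({z | w z ≤ 0} ∩ Ioo (-2 : ℝ) (-1) ×ˢ Metric.ball (0 : Space d) 1)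
  set b := volume.real ({z | lam ≤ w z} ∩ Ioo (-1 : ℝ) 0 ×ˢ Metric.ball (0 : Space d) 1)
  calc lam ^ 2 * a * b = m ^ 2 * ((lam / m) ^ 2 * a * b) := by field_simp
    _ ≤ m ^ 2 * (C * volume.real ({z | 0 < w z ∧ w z < lam} ∩
          Ioo (-2 : ℝ) 0 ×ˢ Metric.ball (0 : Space d) 1) ^ (1 / (4 * p + 2))) := by gcongr
    _ ≤ m ^ 2 * (C * volume.real ({z | k < u z ∧ u z < l} ∩ ParabolicDG.cylinder d 2) ^ (1 / (4 * p + 2))) := by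
        gcongr
    _ = _ := by ring
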